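/- Lemma 2.3. For $i\in\{1,2\}$ let $\partial_{x_i}$ be the distributional partial derivative on $\mathbb R^2$, and let $\Lambda_{x_i}^s$ ($s\in\mathbb R$) be the Fourier multiplier with symbol $|\xi_i|^s$, that is $\widehat{\Lambda_{x_i}^{s}f}(\xi)=|\xi_i|^{s}\hat f(\xi)$, where $\hat f$ is the Fourier transform with kernel $e^{-ix\cdot\xi}$. All norms are taken over $\mathbb R^2$. (a) For every $\gamma\ge 0$ there is a constant $C=C(\gamma)$ such that for $i=1,2$ and every $f\in L^2(\mathbb R^2)\cap L^\infty(\mathbb R^2)$ with $\Lambda_{x_i}^{\gamma}\partial_{x_i}f\in L^2(\mathbb R^2)$, the derivative $\partial_{x_i}f$ is a function in $L^{2(\gamma+1)}(\mathbb R^2)$ and $$\|\partial_{x_i}f\|_{L^{2(\gamma+1)}}\le C\,\|f\|_{L^\infty}^{\frac{\gamma}{\gamma+1}}\,\|\Lambda_{x_i}^{\gamma}\partial_{x_i}f\|_{L^2}^{\frac1{\gamma+1}}.$$ (b) For all real $\varrho>-1$ and $0\le\delta\le\varrho+1$ there is a constant $C=C(\varrho,\delta)$ such that for $i=1,2$ and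 every $f\in L^2(\mathbb R^2)\cap L^\infty(\mathbb R^2)$ with $\Lambda_{x_i}^{\varrho}\partial_{x_i}f\in L^2(\mathbb R^2)$, $\Lambda_{x_i}^{\delta}f$ is a function in $L^{2(\varrho+1)/\delta}(\mathbb R^2)$ and $$\|\Lambda_{x_i}^{\delta}f\|_{L^{\frac{2(\varrho+1)}{\delta}}}\le C\,\|f\|_{L^\infty}^{1-\frac{\delta}{\varrho+1}}\,\|\Lambda_{x_i}^{\varrho}\partial_{x_i}f\|_{L^2}^{\frac{\delta}{\varrho+1}},$$ where $2(\varrho+1)/\delta=\infty$ if $\delta=0$. (Here $0^0=1$.) -/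

import Mathlib

open MeasureTheory SchwartzMap
open scoped ENNReal NNReal FourierTransform LineDeriv

/-- The plane `ℝ²` with its Euclidean structure and Lebesgue measure. -/
abbrev Plane : Type := EuclideanSpace ℝ (Fin 2)

/-- The tempered distribution `u` is (integration against) the function `g`. Integrability against
every Schwartz function is part of the definition, so `g` is locally integrable, and it is
determined by `u` up to a null set. -/
def IsGivenBy (u : 𝓢'(Plane, ℂ)) (g : Plane → ℂ) : Prop :=
  ∀ φ : 𝓢(Plane, ℂ),
    Integrable (fun x => φ x * g x) volume ∧ u φ = ∫ x, φ x * g x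

/-- The distributional partial derivative `∂_{x_i} u`. -/
noncomputable def partialD (i : Fin 2) (u : 𝓢'(Plane, ℂ)) : 𝓢'(Plane, ℂ) :=
  ∂_{(EuclideanSpace.single i (1 : ℝ) : Plane)} u

/-- `v = Λ_{x_i}^s u`, where `Λ_{x_i} = √(-∂_{x_i}²)`: the Fourier transform of `u` is a function
`a`, and the Fourier transform of `v` is that function times the symbol of `Λ_{x_i}^s`. The symbol
is `|ξ_i|^s` for the Fourier transform with kernel `e^{-i x·ξ}`, hence `|2π ξ_i|^s` for `𝓕`, whose
kernel is `e^{-2π i x·ξ}`. Since `𝓕` is injective, `v` is determined by `u`. -/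
def IsLambda (i : Fin 2) (s : ℝ) (u v : 𝓢'(Plane, ℂ)) : Prop :=
  ∃ a : Plane → ℂ, IsGivenBy (𝓕 u) a ∧
    IsGivenBy (𝓕 v) (fun ξ => ((|2 * Real.pi * ξ i| ^ s : ℝ) : ℂ) * a ξ)

/-! ### Tempered distributions given by functions -/

/-! Write `s = ϱ + 1`, with `ϱ = γ` in the first part. Take a finite difference `D_t` with step `t`
in direction `x_i`, whose Fourier symbol is `σ(t ξ_i)` for a trigonometric sum `σ` vanishing at `0`
to order `M > s`. By scaling, `∫_0^∞ t^(-δ-1) σ(t r) dt` is a constant times `|r|^δ` if `σ` is even,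
and a constant times `r` if `σ` is odd and `δ = 1`. Hence `Λ^δ f` and `∂f` are, up to nonzero
constants, integrals `∫_0^∞ t^(-δ-1) D_t f dt`.

Such an integral is interpolated pointwise in `x`. For large `t`, `|D_t f(x)| ≤ L ‖f‖_∞`; for small
`t`, Cauchy-Schwarz gives a bound by the square function `Q(x) = ∫_0^∞ t^(-2s-1) |D_t f(x)|² dt`.
Cutting at the best `t` gives `|W(x)| ≤ C ‖f‖_∞^(1-δ/s) Q(x)^(δ/(2s))` for `0 < δ < s`
(`lintegral_rpow_mul_le_interpolation`, `enorm_ae_le_lintegral_lineDiff`). Raised to the power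
`2s/δ`, the right side is linear in `Q`, and by Plancherel `∫ Q` is at most a constant times `∫
|ξ_i|^(2s) |𝓕 f|²` (`lintegral_lintegral_lineDiff_sq_le`). The pointwise argument needs neither
Littlewood-Paley theory nor maximal functions, so `L^∞` causes no loss.

The constants are nonzero because the even symbol has a fixed sign (`centralConst_ne_zero`) and the
odd symbol is its derivative (`oddConst_eq`). The endpoint `δ = s` is Plancherel; `δ = 0` is
trivial. -/

theorem IsGivenBy.locallyIntegrable {u : 𝓢'(Plane, ℂ)} {g : Plane → ℂ} (h : IsGivenBy u g) :
    LocallyIntegrable g := by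
  intro x
  let b : ContDiffBump x := ⟨1, 2, one_pos, one_lt_two⟩
  have hc : HasCompactSupport (Complex.ofRealCLM ∘ b) := b.hasCompactSupport.comp_left rfl
  have hd : ContDiff ℝ (⊤ : ℕ∞) (Complex.ofRealCLM ∘ b) :=
    Complex.ofRealCLM.contDiff.comp b.contDiff
  refine ⟨Metric.ball x 1, Metric.ball_mem_nhds x one_pos, ?_⟩
  refine ((h (hc.toSchwartzMap hd)).1.integrableOn (s := Metric.ball x 1)).congr_fun ?_
    measurableSet_ball
  intro y hy
  have : b y = 1 := b.one_of_mem_closedBall (Metric.ball_subset_closedBall hy)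
  simp [this]

theorem IsGivenBy.ae_eq {u : 𝓢'(Plane, ℂ)} {g₁ g₂ : Plane → ℂ} (h₁ : IsGivenBy u g₁)
    (h₂ : IsGivenBy u g₂) : g₁ =ᵐ[volume] g₂ := by
  refine ae_eq_of_integral_contDiff_smul_eq h₁.locallyIntegrable h₂.locallyIntegrable ?_
  intro φ hφ hφc
  have hc : HasCompactSupport (Complex.ofRealCLM ∘ φ) := hφc.comp_left rfl
  have hd : ContDiff ℝ (⊤ : ℕ∞) (Complex.ofRealCLM ∘ φ) :=
    Complex.ofRealCLM.contDiff.comp hφ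
  have := ((h₁ (hc.toSchwartzMap hd)).2).symm.trans (h₂ (hc.toSchwartzMap hd)).2
  simpa using this

theorem IsGivenBy.congr_ae {u : 𝓢'(Plane, ℂ)} {g₁ g₂ : Plane → ℂ} (h₁ : IsGivenBy u g₁)
    (h : g₁ =ᵐ[volume] g₂) : IsGivenBy u g₂ := by
  intro φ
  have : (fun x => φ x * g₁ x) =ᵐ[volume] fun x => φ x * g₂ x := by
    filter_upwards [h] with x hx
    rw [hx]
  exact ⟨(h₁ φ).1.congr this, (h₁ φ).2.trans (integral_congr_ae this)⟩

theorem IsGivenBy.distribution_eq {u v : 𝓢'(Plane, ℂ)} {g : Plane → ℂ} (hu : IsGivenBy u g)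
    (hv : IsGivenBy v g) : u = v := by
  ext φ
  rw [(hu φ).2, (hv φ).2]

theorem isGivenBy_Lp (f : Lp ℂ 2 (volume : Measure Plane)) : IsGivenBy (f : 𝓢'(Plane, ℂ)) f := by
  intro φ
  exact ⟨(φ.memLp 2 volume).integrable_mul (Lp.memLp f), by simp⟩

theorem isGivenBy_fourier_Lp (f : Lp ℂ 2 (volume : Measure Plane)) :
    IsGivenBy (𝓕 (f : 𝓢'(Plane, ℂ))) (𝓕 f : Lp ℂ 2 (volume : Measure Plane)) := by
  rw [Lp.fourier_toTemperedDistribution_eq]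
  exact isGivenBy_Lp _

theorem isGivenBy_fourier_partialD (i : Fin 2) (f : Lp ℂ 2 (volume : Measure Plane)) :
    IsGivenBy (𝓕 (partialD i (f : 𝓢'(Plane, ℂ))))
      (fun ξ => 2 * Real.pi * Complex.I * ξ i * (𝓕 f : Lp ℂ 2 (volume : Measure Plane)) ξ) := by
  intro φ
  have ht : (fun ξ : Plane => inner ℝ ξ (EuclideanSpace.single i (1 : ℝ))).HasTemperateGrowth := by
    fun_prop
  have key := isGivenBy_fourier_Lp f (SchwartzMap.smulLeftCLM ℂ
    (fun ξ : Plane => inner ℝ ξ (EuclideanSpace.single i (1 : ℝ))) φ)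
  have e : (fun x => φ x * (2 * Real.pi * Complex.I * x i *
      (𝓕 f : Lp ℂ 2 (volume : Measure Plane)) x)) = fun x => (2 * Real.pi * Complex.I) *
      ((SchwartzMap.smulLeftCLM ℂ
        (fun ξ : Plane => inner ℝ ξ (EuclideanSpace.single i (1 : ℝ))) φ) x *
      (𝓕 f : Lp ℂ 2 (volume : Measure Plane)) x) := by
    ext x
    rw [SchwartzMap.smulLeftCLM_apply_apply ht]
    simp [EuclideanSpace.inner_single_right]
    ring
  rw [e]
  refine ⟨key.1.const_mul _, ?_⟩
  rw [integral_const_mul, ← key.2, partialD, TemperedDistribution.fourier_lineDerivOp_eq]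
  have := SchwartzMap.smulLeftCLM_ofReal ℂ ht (F := ℂ)
  simp [← this]

theorem fourierInv_compSubConst (g : 𝓢(Plane, ℂ)) (v ξ : Plane) :
    (𝓕⁻ (g.compSubConstCLM ℂ v)) ξ =
      Complex.exp (2 * Real.pi * Complex.I * (inner ℝ v ξ : ℝ)) * (𝓕⁻ g) ξ := by
  rw [fourierInv_coe, fourierInv_coe, Real.fourierInv_eq, Real.fourierInv_eq,
    ← integral_const_mul, ← integral_add_right_eq_self _ v]
  refine integral_congr_ae (.of_forall fun x => ?_)
  simp only [compSubConstCLM_apply, add_sub_cancel_right, inner_add_left, AddChar.map_add_eq_mul,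
    Circle.smul_def, Circle.coe_mul, smul_eq_mul]
  simp only [Real.fourierChar_apply]
  push_cast
  ring_nf

/-- The `L²` Fourier transform turns a translation into a modulation. -/
theorem fourier_translate {f : Plane → ℂ} (hf : MemLp f 2 volume) (v : Plane)
    (hfv : MemLp (fun x => f (x + v)) 2 volume) :
    (𝓕 (hfv.toLp _) : Lp ℂ 2 (volume : Measure Plane)) =ᵐ[volume]
      fun ξ => Complex.exp (2 * Real.pi * Complex.I * (inner ℝ v ξ : ℝ)) *
        (𝓕 (hf.toLp f) : Lp ℂ 2 (volume : Measure Plane)) ξ := by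
  refine (isGivenBy_fourier_Lp _).ae_eq fun φ => ?_
  -- Duality: the modulation is moved onto the test function, where it becomes a translation of `𝓕
  -- φ`.
  have key := isGivenBy_fourier_Lp (hf.toLp f) (𝓕⁻ ((𝓕 φ).compSubConstCLM ℂ v))
  have e : ∀ x, φ x * (Complex.exp (2 * Real.pi * Complex.I * (inner ℝ v x : ℝ)) *
        (𝓕 (hf.toLp f) : Lp ℂ 2 (volume : Measure Plane)) x) =
      (𝓕⁻ ((𝓕 φ).compSubConstCLM ℂ v)) x *
        (𝓕 (hf.toLp f) : Lp ℂ 2 (volume : Measure Plane)) x := by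
    intro x
    rw [fourierInv_compSubConst, FourierTransform.fourierInv_fourier_eq]
    ring
  simp only [e]
  refine ⟨key.1, ?_⟩
  rw [← key.2, TemperedDistribution.fourier_apply, TemperedDistribution.fourier_apply,
    FourierTransform.fourier_fourierInv_eq, (isGivenBy_Lp _ _).2, (isGivenBy_Lp _ _).2]
  refine Eq.trans (integral_congr_ae ?_) (integral_add_right_eq_self _ v)
  have h1 := (measurePreserving_add_right volume v).quasiMeasurePreserving.ae_eq_comp
    hf.coeFn_toLp
  filter_upwards [hfv.coeFn_toLp, h1] with x hx hx1
  simp only [Function.comp_apply] at hx1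
  simp [hx, hx1]

/-! ### Weighted integrals on the half line -/

theorem lintegral_rpow_Ioc_zero {q T : ℝ} (hq : 0 < q) (hT : 0 ≤ T) :
    ∫⁻ t in Set.Ioc 0 T, ENNReal.ofReal (t ^ (q - 1)) = ENNReal.ofReal (T ^ q / q) := by
  rw [← ofReal_integral_eq_lintegral_ofReal, ← intervalIntegral.integral_of_le hT, integral_rpow]
  · rw [sub_add_cancel, Real.zero_rpow hq.ne', sub_zero]
  · left; linarith
  · exact (intervalIntegrable_iff_integrableOn_Ioc_of_le hT).1
      (intervalIntegral.intervalIntegrable_rpow' (by linarith))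
  · filter_upwards [ae_restrict_mem measurableSet_Ioc] with t ht
    exact Real.rpow_nonneg ht.1.le _

theorem lintegral_rpow_Ioi {q T : ℝ} (hq : 0 < q) (hT : 0 < T) :
    ∫⁻ t in Set.Ioi T, ENNReal.ofReal (t ^ (-q - 1)) = ENNReal.ofReal (T ^ (-q) / q) := by
  rw [← ofReal_integral_eq_lintegral_ofReal, integral_Ioi_rpow_of_lt (by linarith) hT]
  · rw [sub_add_cancel, div_neg, neg_div, neg_neg]
  · exact integrableOn_Ioi_rpow_of_lt (by linarith) hT
  · filter_upwards [ae_restrict_mem measurableSet_Ioi] with t ht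
    exact Real.rpow_nonneg (hT.trans ht).le _

theorem lintegral_Ioi_zero_eq_add {T : ℝ} (hT : 0 ≤ T) (g : ℝ → ℝ≥0∞) :
    ∫⁻ t in Set.Ioi 0, g t = (∫⁻ t in Set.Ioc 0 T, g t) + ∫⁻ t in Set.Ioi T, g t := by
  rw [← Set.Ioc_union_Ioi_eq_Ioi hT,
    lintegral_union measurableSet_Ioi (Set.Ioc_disjoint_Ioi le_rfl)]

/-- A function bounded by `min 1 |t| ^ M` has Mellin-type integrals of order `0 < q < M`, with the
expected dependence on the dilation parameter. -/
theorem lintegral_rpow_mul_comp_mul_le {g : ℝ → ℝ≥0∞} {B M q : ℝ} (hB : 0 ≤ B) (hq : 0 < q)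
    (hqM : q < M) (h1 : ∀ t, g t ≤ ENNReal.ofReal B)
    (hM : ∀ t, g t ≤ ENNReal.ofReal (B * |t| ^ M)) (r : ℝ) :
    ∫⁻ t in Set.Ioi 0, ENNReal.ofReal (t ^ (-q - 1)) * g (t * r) ≤
      ENNReal.ofReal (B * (1 / (M - q) + 1 / q) * |r| ^ q) := by
  rcases eq_or_ne r 0 with rfl | hr
  · have : g 0 = 0 := by simpa [Real.zero_rpow (hq.trans hqM).ne'] using hM 0
    simp [this]
  have hr' : 0 < |r| := abs_pos.2 hr
  have hT : 0 < |r|⁻¹ := inv_pos.2 hr'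
  have hMq : 0 < M - q := sub_pos.2 hqM
  -- Cut at `t = 1/|r|`, where the two bounds on `g (t * r)` agree.
  rw [lintegral_Ioi_zero_eq_add hT.le]
  have e1 : ∫⁻ t in Set.Ioc 0 |r|⁻¹, ENNReal.ofReal (t ^ (-q - 1)) * g (t * r) ≤
      ENNReal.ofReal (B * |r| ^ q / (M - q)) := by
    calc _ ≤ ∫⁻ t in Set.Ioc 0 |r|⁻¹, ENNReal.ofReal (B * |r| ^ M) *
            ENNReal.ofReal (t ^ (M - q - 1)) := by
          refine setLIntegral_mono' measurableSet_Ioc fun t ht => ?_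
          refine (mul_le_mul_right (hM _) _).trans ?_
          rw [← ENNReal.ofReal_mul (Real.rpow_nonneg ht.1.le _), ← ENNReal.ofReal_mul (by positivity),
            abs_mul, abs_of_pos ht.1, Real.mul_rpow ht.1.le hr'.le,
            show M - q - 1 = (-q - 1) + M by ring, Real.rpow_add ht.1]
          exact le_of_eq (by ring_nf)
      _ = _ := by
          rw [lintegral_const_mul' _ _ ENNReal.ofReal_ne_top, lintegral_rpow_Ioc_zero hMq hT.le,
            ← ENNReal.ofReal_mul (by positivity), Real.inv_rpow hr'.le, ← Real.rpow_neg hr'.le]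
          congr 1
          rw [mul_div_assoc', mul_assoc, ← Real.rpow_add hr']
          ring_nf
  have e2 : ∫⁻ t in Set.Ioi |r|⁻¹, ENNReal.ofReal (t ^ (-q - 1)) * g (t * r) ≤
      ENNReal.ofReal (B * |r| ^ q / q) := by
    calc _ ≤ ∫⁻ t in Set.Ioi |r|⁻¹, ENNReal.ofReal B * ENNReal.ofReal (t ^ (-q - 1)) := by
          refine setLIntegral_mono' measurableSet_Ioi fun t ht => ?_
          rw [mul_comm (ENNReal.ofReal B)]
          exact mul_le_mul_right (h1 _) _
      _ = _ := by
          rw [lintegral_const_mul' _ _ ENNReal.ofReal_ne_top, lintegral_rpow_Ioi hq hT,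
            ← ENNReal.ofReal_mul hB, Real.inv_rpow hr'.le, ← Real.rpow_neg hr'.le, neg_neg]
          congr 1
          ring
  refine (add_le_add e1 e2).trans (le_of_eq ?_)
  rw [← ENNReal.ofReal_add (by positivity) (by positivity)]
  congr 1
  ring

/-- Cauchy-Schwarz with `t^(-δ-1) = t^(s-δ-1/2) · t^(-s-1/2)`. The first factor is square integrable
at `0` because `δ < s`. -/
theorem lintegral_Ioc_rpow_mul_le {d : ℝ → ℝ≥0∞} (hd : Measurable d) {δ s T : ℝ}
    (hδs : δ < s) (hT : 0 ≤ T) :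
    ∫⁻ t in Set.Ioc 0 T, ENNReal.ofReal (t ^ (-δ - 1)) * d t ≤
      ENNReal.ofReal (T ^ (2 * (s - δ)) / (2 * (s - δ))) ^ (1 / 2 : ℝ) *
        (∫⁻ t in Set.Ioi 0, ENNReal.ofReal (t ^ (-(2 * s) - 1)) * d t ^ 2) ^ (1 / 2 : ℝ) := by
  have key := ENNReal.lintegral_mul_le_Lp_mul_Lq (volume.restrict (Set.Ioc 0 T))
    (p := 2) (q := 2) (Real.HolderConjugate.two_two)
    (f := fun t => ENNReal.ofReal (t ^ (s - δ - 1 / 2)))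
    (g := fun t => ENNReal.ofReal (t ^ (-s - 1 / 2)) * d t)
    (by fun_prop) (by fun_prop)
  calc _ = ∫⁻ t in Set.Ioc 0 T, ((fun t => ENNReal.ofReal (t ^ (s - δ - 1 / 2))) *
          fun t => ENNReal.ofReal (t ^ (-s - 1 / 2)) * d t) t := by
        refine setLIntegral_congr_fun measurableSet_Ioc fun t ht => ?_
        simp only [Pi.mul_apply]
        rw [← mul_assoc, ← ENNReal.ofReal_mul (Real.rpow_nonneg ht.1.le _), ← Real.rpow_add ht.1]
        ring_nf
    _ ≤ _ := key
    _ ≤ _ := by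
        refine mul_le_mul' (le_of_eq ?_) ?_
        · rw [← lintegral_rpow_Ioc_zero (by linarith) hT]
          congr 1
          refine setLIntegral_congr_fun measurableSet_Ioc fun t ht => ?_
          rw [ENNReal.ofReal_rpow_of_nonneg (Real.rpow_nonneg ht.1.le _) (by norm_num),
            ← Real.rpow_mul ht.1.le]
          ring_nf
        · refine ENNReal.rpow_le_rpow ?_ (by norm_num)
          refine (setLIntegral_mono' measurableSet_Ioc fun t ht => ?_).trans
            (lintegral_mono_set Set.Ioc_subset_Ioi_self)
          rw [ENNReal.mul_rpow_of_nonneg _ _ (by norm_num), ENNReal.rpow_two, ENNReal.rpow_two,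
            ← ENNReal.ofReal_pow (Real.rpow_nonneg ht.1.le _), ← Real.rpow_natCast,
            ← Real.rpow_mul ht.1.le]
          refine le_of_eq ?_
          congr 3
          push_cast
          ring

/-- Interpolation between a bound in `L^∞` and a weighted `L²` bound. -/
theorem lintegral_rpow_mul_le_interpolation {d : ℝ → ℝ≥0∞} (hd : Measurable d) {δ s : ℝ}
    (hδ : 0 < δ) (hδs : δ < s) {A : ℝ≥0∞} (hA : A ≠ ∞) (hdA : ∀ t, d t ≤ A) :
    ∫⁻ t in Set.Ioi 0, ENNReal.ofReal (t ^ (-δ - 1)) * d t ≤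
      ENNReal.ofReal ((1 / (2 * (s - δ))) ^ (1 / 2 : ℝ) + 1 / δ) * A ^ (1 - δ / s) *
        (∫⁻ t in Set.Ioi 0, ENNReal.ofReal (t ^ (-(2 * s) - 1)) * d t ^ 2) ^ (δ / (2 * s)) := by
  have hs : 0 < s := hδ.trans hδs
  have hsδ : 0 < s - δ := sub_pos.2 hδs
  have hθ : 0 < 1 - δ / s := by rw [sub_pos, div_lt_one hs]; exact hδs
  -- The cut `T` below needs `A` and `Q` positive and finite. If `A = 0` or `Q = 0` the left side
  -- vanishes; if `Q = ∞` the right side is `∞`, as `A ≠ 0` by then.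
  rcases eq_or_ne A 0 with rfl | hA0
  · have : ∀ t, d t = 0 := fun t => le_antisymm (hdA t) bot_le
    simp [this]
  set Q := ∫⁻ t in Set.Ioi 0, ENNReal.ofReal (t ^ (-(2 * s) - 1)) * d t ^ 2 with hQ
  rcases eq_or_ne Q ∞ with hQt | hQt
  · rw [hQt, ENNReal.top_rpow_of_pos (by positivity), ENNReal.mul_top]
    · exact le_top
    · refine mul_ne_zero (ENNReal.ofReal_pos.2 (by positivity)).ne' ?_
      simp [ENNReal.rpow_eq_zero_iff, hA0, hA]
  rcases eq_or_ne Q 0 with hQ0 | hQ0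
  · have h0 : ∫⁻ t in Set.Ioi 0, ENNReal.ofReal (t ^ (-δ - 1)) * d t = 0 := by
      rw [lintegral_eq_zero_iff (by fun_prop)]
      rw [hQ, lintegral_eq_zero_iff (by fun_prop)] at hQ0
      filter_upwards [hQ0, ae_restrict_mem measurableSet_Ioi] with t ht ht0
      have ht0 : 0 < t := ht0
      have h1 : ENNReal.ofReal (t ^ (-(2 * s) - 1)) ≠ 0 :=
        (ENNReal.ofReal_pos.2 (Real.rpow_pos_of_pos ht0 _)).ne'
      simp only [Pi.zero_apply, mul_eq_zero, h1, false_or] at ht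
      simp [pow_eq_zero_iff two_ne_zero |>.1 ht]
    rw [h0]
    exact bot_le
  lift A to ℝ≥0 using hA
  clear_value Q
  lift Q to ℝ≥0 using hQt
  have hA' : 0 < (A : ℝ) := by simpa [pos_iff_ne_zero] using hA0
  have hQ' : 0 < (Q : ℝ) := by simpa [pos_iff_ne_zero] using hQ0
  -- This `T` balances the two pieces: `T^(s-δ) Q^(1/2)` and `T^(-δ) A` both equal `A^(1-δ/s)
  -- Q^(δ/(2s))`.
  set T : ℝ := (A : ℝ) ^ (1 / s) * (Q : ℝ) ^ (-(1 / (2 * s))) with hT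
  have hT0 : 0 < T := by positivity
  have hTp : ∀ p : ℝ, T ^ p = (A : ℝ) ^ (p / s) * (Q : ℝ) ^ (-(p / (2 * s))) := by
    intro p
    rw [hT, Real.mul_rpow (by positivity) (by positivity), ← Real.rpow_mul hA'.le,
      ← Real.rpow_mul hQ'.le]
    congr 2 <;> ring
  rw [lintegral_Ioi_zero_eq_add hT0.le]
  have e1 := lintegral_Ioc_rpow_mul_le hd hδs hT0.le
  rw [← hQ] at e1
  have e2 : ∫⁻ t in Set.Ioi T, ENNReal.ofReal (t ^ (-δ - 1)) * d t ≤
      ENNReal.ofReal (T ^ (-δ) / δ) * A := by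
    rw [← lintegral_rpow_Ioi hδ hT0, ← lintegral_mul_const' _ _ ENNReal.coe_ne_top]
    exact lintegral_mono fun t => mul_le_mul_right (hdA t) _
  refine (add_le_add e1 e2).trans (le_of_eq ?_)
  have hAe : (A : ℝ≥0∞) = ENNReal.ofReal A := by simp
  have hQe : (Q : ℝ≥0∞) = ENNReal.ofReal Q := by simp
  rw [hAe, hQe, ENNReal.ofReal_rpow_of_pos hA', ENNReal.ofReal_rpow_of_pos hQ',
    ENNReal.ofReal_rpow_of_pos hQ', ENNReal.ofReal_rpow_of_pos (by positivity),
    ← ENNReal.ofReal_mul (by positivity), ← ENNReal.ofReal_mul (by positivity),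
    ← ENNReal.ofReal_mul (by positivity), ← ENNReal.ofReal_mul (by positivity),
    ← ENNReal.ofReal_add (by positivity) (by positivity)]
  congr 1
  rw [div_eq_mul_one_div (T ^ (2 * (s - δ))), Real.mul_rpow (by positivity) (by positivity),
    ← Real.rpow_mul hT0.le, hTp, hTp]
  have a1 : (A : ℝ) ^ (-δ / s) * A = (A : ℝ) ^ (1 - δ / s) := by
    nth_rewrite 2 [← Real.rpow_one (A : ℝ)]
    rw [← Real.rpow_add hA']
    ring_nf
  have a2 : (Q : ℝ) ^ (-(2 * (s - δ) * (1 / 2) / (2 * s))) * (Q : ℝ) ^ (1 / 2 : ℝ) =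
      (Q : ℝ) ^ (δ / (2 * s)) := by
    rw [← Real.rpow_add hQ']
    congr 1
    field_simp
    ring
  have a3 : (2 * (s - δ) * (1 / 2) / s) = 1 - δ / s := by field_simp
  have a4 : (-(-δ / (2 * s))) = δ / (2 * s) := by ring
  rw [a3, a4]
  calc _ = (1 / (2 * (s - δ))) ^ (1 / 2 : ℝ) * (A : ℝ) ^ (1 - δ / s) *
        ((Q : ℝ) ^ (-(2 * (s - δ) * (1 / 2) / (2 * s))) * (Q : ℝ) ^ (1 / 2 : ℝ)) +
        1 / δ * ((A : ℝ) ^ (-δ / s) * A) * (Q : ℝ) ^ (δ / (2 * s)) := by ring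
    _ = _ := by rw [a1, a2]; ring

/-! ### Finite differences along a coordinate direction -/

/-- The trigonometric sum with coefficients `c` and frequencies `a`. -/
noncomputable def trigSum (n : ℕ) (c : ℕ → ℂ) (a : ℕ → ℝ) (r : ℝ) : ℂ :=
  ∑ k ∈ Finset.range n, c k * Complex.exp (2 * Real.pi * Complex.I * (a k * r : ℝ))

/-- The difference operator in direction `x_i` with step `t`, whose Fourier symbol is
`trigSum n c a (t * ξ i)`. -/
noncomputable def lineDiff (n : ℕ) (c : ℕ → ℂ) (a : ℕ → ℝ) (i : Fin 2) (t : ℝ) (f : Plane → ℂ)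
    (x : Plane) : ℂ :=
  ∑ k ∈ Finset.range n, c k * f (x + EuclideanSpace.single i (a k * t))

section

variable {n : ℕ} {c : ℕ → ℂ} {a : ℕ → ℝ} {i : Fin 2}

theorem continuous_trigSum : Continuous (trigSum n c a) := by
  unfold trigSum
  fun_prop

theorem memLp_translate {f : Plane → ℂ} (hf : MemLp f 2 volume) (v : Plane) :
    MemLp (fun x => f (x + v)) 2 volume :=
  hf.comp_measurePreserving (measurePreserving_add_right volume v)

theorem memLp_lineDiff {f : Plane → ℂ} (hf : MemLp f 2 volume) (t : ℝ) :
    MemLp (lineDiff n c a i t f) 2 volume := by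
  unfold lineDiff
  exact memLp_finsetSum _ fun k _ => (memLp_translate hf _).const_mul (c k)

/-- Joint measurability in `(x, t)` is what Tonelli needs later; it is the reason for working with a
Borel representative of `f`. -/
theorem measurable_lineDiff {f : Plane → ℂ} (hf : Measurable f) :
    Measurable fun p : Plane × ℝ => lineDiff n c a i p.2 f p.1 := by
  unfold lineDiff
  refine Finset.measurable_sum _ fun k _ => measurable_const.mul (hf.comp ?_)
  have : Continuous fun p : Plane × ℝ => p.1 + EuclideanSpace.single i (a k * p.2) := by
    have h : ∀ r : ℝ, (EuclideanSpace.single i r : Plane) =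
        r • (EuclideanSpace.single i (1 : ℝ) : Plane) := by
      intro r
      ext j
      by_cases hj : j = i <;> simp [hj]
    simp only [h (a k * _)]
    fun_prop
  exact this.measurable

theorem enorm_lineDiff_le {f : Plane → ℂ} {A : ℝ≥0∞} (hf : ∀ x, ‖f x‖ₑ ≤ A) (t : ℝ) (x : Plane) :
    ‖lineDiff n c a i t f x‖ₑ ≤ ENNReal.ofReal (∑ k ∈ Finset.range n, ‖c k‖) * A := by
  rw [ENNReal.ofReal_sum_of_nonneg fun k _ => norm_nonneg _, Finset.sum_mul]
  refine (enorm_sum_le _ _).trans (Finset.sum_le_sum fun k _ => ?_)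
  rw [enorm_mul, ofReal_norm]
  exact mul_le_mul_right (hf _) _

theorem fourier_lineDiff {f : Plane → ℂ} (hf : MemLp f 2 volume) (t : ℝ) :
    (𝓕 ((memLp_lineDiff (n := n) (c := c) (a := a) (i := i) hf t).toLp _) :
      Lp ℂ 2 (volume : Measure Plane)) =ᵐ[volume]
      fun ξ => trigSum n c a (t * ξ i) *
        (𝓕 (hf.toLp f) : Lp ℂ 2 (volume : Measure Plane)) ξ := by
  have hsum : (memLp_lineDiff (n := n) (c := c) (a := a) (i := i) hf t).toLp _ =
      ∑ k ∈ Finset.range n, c k •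
        (memLp_translate hf (EuclideanSpace.single i (a k * t))).toLp _ := by
    refine Lp.ext ?_
    refine (MemLp.coeFn_toLp _).trans ?_
    have h1 : ∀ k ∈ Finset.range n,
        (c k • (memLp_translate hf (EuclideanSpace.single i (a k * t))).toLp _ :
          Lp ℂ 2 (volume : Measure Plane)) =ᵐ[volume]
        fun x => c k * f (x + EuclideanSpace.single i (a k * t)) := by
      intro k _
      filter_upwards [Lp.coeFn_smul (c k)
        ((memLp_translate hf (EuclideanSpace.single i (a k * t))).toLp _),
        (memLp_translate hf (EuclideanSpace.single i (a k * t))).coeFn_toLp] with x h2 h3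
      rw [h2, Pi.smul_apply, h3, smul_eq_mul]
    have h4 := (Finset.range n).eventually_all.2 h1
    filter_upwards [h4, Lp.coeFn_finsetSum (Finset.range n) fun k => c k •
        (memLp_translate hf (EuclideanSpace.single i (a k * t))).toLp _] with x hx hx'
    rw [hx', Finset.sum_apply, Finset.sum_congr rfl hx]
    rfl
  have hF : (𝓕 ((memLp_lineDiff (n := n) (c := c) (a := a) (i := i) hf t).toLp _) :
      Lp ℂ 2 (volume : Measure Plane)) = ∑ k ∈ Finset.range n, c k •
        (𝓕 ((memLp_translate hf (EuclideanSpace.single i (a k * t))).toLp _) :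
          Lp ℂ 2 (volume : Measure Plane)) := by
    rw [hsum]
    change Lp.fourierTransformₗᵢ Plane ℂ _ = ∑ k ∈ Finset.range n, c k •
      Lp.fourierTransformₗᵢ Plane ℂ _
    simp only [map_sum, map_smul]
  rw [hF]
  have h1 : ∀ k ∈ Finset.range n,
      (c k • (𝓕 ((memLp_translate hf (EuclideanSpace.single i (a k * t))).toLp _) :
          Lp ℂ 2 (volume : Measure Plane)) : Lp ℂ 2 (volume : Measure Plane)) =ᵐ[volume]
      fun ξ => c k * Complex.exp (2 * Real.pi * Complex.I * (a k * (t * ξ i) : ℝ)) *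
        (𝓕 (hf.toLp f) : Lp ℂ 2 (volume : Measure Plane)) ξ := by
    intro k _
    filter_upwards [Lp.coeFn_smul (c k)
      (𝓕 ((memLp_translate hf (EuclideanSpace.single i (a k * t))).toLp _) :
          Lp ℂ 2 (volume : Measure Plane)),
      fourier_translate hf (EuclideanSpace.single i (a k * t)) (memLp_translate hf _)]
      with ξ h2 h3
    rw [h2, Pi.smul_apply, h3, smul_eq_mul, ← mul_assoc]
    congr 4
    simp [EuclideanSpace.inner_single_left]
    ring
  have h4 := (Finset.range n).eventually_all.2 h1
  filter_upwards [h4, Lp.coeFn_finsetSum (Finset.range n) fun k => c k •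
        (𝓕 ((memLp_translate hf (EuclideanSpace.single i (a k * t))).toLp _) :
          Lp ℂ 2 (volume : Measure Plane))] with x hx hx'
  rw [hx', Finset.sum_apply, Finset.sum_congr rfl hx, trigSum, Finset.sum_mul]

/-! ### Plancherel and the square function of the differences. -/

theorem lintegral_enorm_sq_eq_norm (g : Lp ℂ 2 (volume : Measure Plane)) :
    ∫⁻ x, ‖g x‖ₑ ^ 2 = ‖g‖ₑ ^ 2 := by
  rw [Lp.enorm_def, eLpNorm_eq_lintegral_rpow_enorm_toReal two_ne_zero ENNReal.ofNat_ne_top]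
  simp only [ENNReal.toReal_ofNat, ENNReal.rpow_two]
  rw [← ENNReal.rpow_two, ← ENNReal.rpow_mul]
  norm_num

theorem lintegral_fourier_enorm_sq (g : Lp ℂ 2 (volume : Measure Plane)) :
    ∫⁻ x, ‖(𝓕 g : Lp ℂ 2 (volume : Measure Plane)) x‖ₑ ^ 2 = ∫⁻ x, ‖g x‖ₑ ^ 2 := by
  rw [lintegral_enorm_sq_eq_norm, lintegral_enorm_sq_eq_norm, ← ofReal_norm, ← ofReal_norm,
    Lp.norm_fourier_eq]

theorem lintegral_lineDiff_sq {f : Plane → ℂ} (hf : MemLp f 2 volume) (t : ℝ) :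
    ∫⁻ x, ‖lineDiff n c a i t f x‖ₑ ^ 2 = ∫⁻ ξ, ‖trigSum n c a (t * ξ i)‖ₑ ^ 2 *
      ‖(𝓕 (hf.toLp f) : Lp ℂ 2 (volume : Measure Plane)) ξ‖ₑ ^ 2 := by
  have hD := memLp_lineDiff (n := n) (c := c) (a := a) (i := i) hf t
  have e : ∫⁻ x, ‖lineDiff n c a i t f x‖ₑ ^ 2 = ∫⁻ x, ‖hD.toLp _ x‖ₑ ^ 2 :=
    lintegral_congr_ae (hD.coeFn_toLp.symm.fun_comp fun z => ‖z‖ₑ ^ 2)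
  rw [e, ← lintegral_fourier_enorm_sq]
  refine lintegral_congr_ae ?_
  filter_upwards [fourier_lineDiff hf t] with ξ hξ
  rw [hξ, enorm_mul, mul_pow]

/-- The weighted square function of the differences is controlled by a homogeneous Sobolev norm. -/
theorem lintegral_lintegral_lineDiff_sq_le {f : Plane → ℂ} (hfm : Measurable f)
    (hf : MemLp f 2 volume) {B M s : ℝ} (hs : 0 < s) (hsM : s < M)
    (h1 : ∀ r, ‖trigSum n c a r‖ ≤ B) (hM : ∀ r, ‖trigSum n c a r‖ ≤ B * |r| ^ M) :
    ∫⁻ x, ∫⁻ t in Set.Ioi 0, ENNReal.ofReal (t ^ (-(2 * s) - 1)) *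
        ‖lineDiff n c a i t f x‖ₑ ^ 2 ≤
      ENNReal.ofReal (B ^ 2 * (1 / (2 * M - 2 * s) + 1 / (2 * s))) *
        ∫⁻ ξ : Plane, ENNReal.ofReal (|ξ i| ^ (2 * s)) *
          ‖(𝓕 (hf.toLp f) : Lp ℂ 2 (volume : Measure Plane)) ξ‖ₑ ^ 2 := by
  have hmeas := measurable_lineDiff (n := n) (c := c) (a := a) (i := i) hfm
  have hFm : Measurable (𝓕 (hf.toLp f) : Lp ℂ 2 (volume : Measure Plane)) :=
    (Lp.stronglyMeasurable _).measurable
  have hσ : Measurable fun p : ℝ × Plane => trigSum n c a (p.1 * p.2 i) :=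
    continuous_trigSum.measurable.comp (by fun_prop)
  -- Tonelli is used twice: here, to apply Plancherel in `x` at fixed `t`; then again, to evaluate
  -- the `t`-integral by scaling at fixed `ξ`.
  rw [lintegral_lintegral_swap]
  swap
  · exact ((by fun_prop : Measurable fun p : Plane × ℝ =>
      ENNReal.ofReal (p.2 ^ (-(2 * s) - 1))).mul (hmeas.enorm.pow_const 2)).aemeasurable
  have e1 : ∀ t : ℝ, ∫⁻ x, ENNReal.ofReal (t ^ (-(2 * s) - 1)) *
        ‖lineDiff n c a i t f x‖ₑ ^ 2 =
      ∫⁻ ξ, ENNReal.ofReal (t ^ (-(2 * s) - 1)) * (‖trigSum n c a (t * ξ i)‖ₑ ^ 2 *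
      ‖(𝓕 (hf.toLp f) : Lp ℂ 2 (volume : Measure Plane)) ξ‖ₑ ^ 2) := by
    intro t
    rw [lintegral_const_mul' _ _ ENNReal.ofReal_ne_top,
      lintegral_const_mul' _ _ ENNReal.ofReal_ne_top, lintegral_lineDiff_sq hf]
  simp only [e1]
  rw [lintegral_lintegral_swap, ← lintegral_const_mul' _ _ ENNReal.ofReal_ne_top]
  swap
  · exact ((by fun_prop : Measurable fun p : ℝ × Plane =>
      ENNReal.ofReal (p.1 ^ (-(2 * s) - 1))).mul ((hσ.enorm.pow_const 2).mul
        ((hFm.comp measurable_snd).enorm.pow_const 2))).aemeasurable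
  refine lintegral_mono fun ξ => ?_
  have e2 : ∀ t : ℝ, ENNReal.ofReal (t ^ (-(2 * s) - 1)) * (‖trigSum n c a (t * ξ i)‖ₑ ^ 2 *
      ‖(𝓕 (hf.toLp f) : Lp ℂ 2 (volume : Measure Plane)) ξ‖ₑ ^ 2) =
      (ENNReal.ofReal (t ^ (-(2 * s) - 1)) * ‖trigSum n c a (t * ξ i)‖ₑ ^ 2) *
      ‖(𝓕 (hf.toLp f) : Lp ℂ 2 (volume : Measure Plane)) ξ‖ₑ ^ 2 := fun t => by ring
  simp only [e2]
  rw [lintegral_mul_const' _ _ (by simp), ← mul_assoc, ← ENNReal.ofReal_mul (by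
    have : 0 < 2 * M - 2 * s := by linarith
    positivity)]
  gcongr
  refine lintegral_rpow_mul_comp_mul_le (g := fun r => ‖trigSum n c a r‖ₑ ^ 2) (sq_nonneg B)
    (by linarith) (by linarith) (fun t => ?_) (fun t => ?_) (ξ i)
  · rw [← ofReal_norm, ← ENNReal.ofReal_pow (norm_nonneg _)]
    exact ENNReal.ofReal_le_ofReal (pow_le_pow_left₀ (norm_nonneg _) (h1 t) 2)
  · rw [← ofReal_norm, ← ENNReal.ofReal_pow (norm_nonneg _)]
    refine ENNReal.ofReal_le_ofReal ((pow_le_pow_left₀ (norm_nonneg _) (hM t) 2).trans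
      (le_of_eq ?_))
    rw [mul_pow, ← Real.rpow_natCast (|t| ^ M), ← Real.rpow_mul (abs_nonneg _)]
    push_cast
    ring_nf

end

/-! ### Functions represented by an integral of differences -/

section

variable {n : ℕ} {c : ℕ → ℂ} {a : ℕ → ℝ} {i : Fin 2}

theorem lintegral_rpow_mul_trigSum_le {B M δ : ℝ} (hδ : 0 < δ) (hδM : δ < M)
    (h1 : ∀ r, ‖trigSum n c a r‖ ≤ B) (hM : ∀ r, ‖trigSum n c a r‖ ≤ B * |r| ^ M) (r : ℝ) :
    ∫⁻ t in Set.Ioi 0, ENNReal.ofReal (t ^ (-δ - 1)) * ‖trigSum n c a (t * r)‖ₑ ≤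
      ENNReal.ofReal (B * (1 / (M - δ) + 1 / δ)) * ENNReal.ofReal (|r| ^ δ) := by
  have hB : 0 ≤ B := (norm_nonneg _).trans (h1 0)
  have : 0 < M - δ := sub_pos.2 hδM
  rw [← ENNReal.ofReal_mul (by positivity)]
  refine lintegral_rpow_mul_comp_mul_le (g := fun r => ‖trigSum n c a r‖ₑ) hB hδ hδM
    (fun t => ?_) (fun t => ?_) r
  · rw [← ofReal_norm]
    exact ENNReal.ofReal_le_ofReal (h1 t)
  · rw [← ofReal_norm]
    exact ENNReal.ofReal_le_ofReal (hM t)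

theorem lintegral_mul_le_sqrt {F G : Plane → ℂ} (hF : Measurable F) (hG : Measurable G)
    {w : Plane → ℝ} (hw : Measurable w) (hw0 : ∀ x, 0 ≤ w x) :
    ∫⁻ x, ENNReal.ofReal (w x) * (‖F x‖ₑ * ‖G x‖ₑ) ≤
      (∫⁻ x, ENNReal.ofReal (w x ^ 2) * ‖F x‖ₑ ^ 2) ^ (1 / 2 : ℝ) *
        (∫⁻ x, ‖G x‖ₑ ^ 2) ^ (1 / 2 : ℝ) := by
  have key := ENNReal.lintegral_mul_le_Lp_mul_Lq (volume : Measure Plane)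
    (p := 2) (q := 2) (Real.HolderConjugate.two_two)
    (f := fun x => ENNReal.ofReal (w x) * ‖F x‖ₑ)
    (g := fun x => ‖G x‖ₑ) (by fun_prop) (by fun_prop)
  simp only [Pi.mul_apply, ENNReal.rpow_two, mul_pow, mul_assoc,
    ← ENNReal.ofReal_pow (hw0 _)] at key
  exact key

/-- The double integral defining the pairing on the Fourier side converges absolutely. -/
theorem integrable_rpow_mul_trigSum_mul {F G : Plane → ℂ} (hFm : Measurable F)
    (hGm : Measurable G) {B M δ : ℝ} (hδ : 0 < δ) (hδM : δ < M)
    (h1 : ∀ r, ‖trigSum n c a r‖ ≤ B) (hM : ∀ r, ‖trigSum n c a r‖ ≤ B * |r| ^ M)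
    (hF : ∫⁻ ξ : Plane, ENNReal.ofReal ((|ξ i| ^ δ) ^ 2) * ‖F ξ‖ₑ ^ 2 ≠ ∞)
    (hG : ∫⁻ ξ : Plane, ‖G ξ‖ₑ ^ 2 ≠ ∞) :
    Integrable (fun p : Plane × ℝ => ((p.2 ^ (-δ - 1) : ℝ) : ℂ) * trigSum n c a (p.2 * p.1 i) *
      inner ℂ (G p.1) (F p.1)) ((volume : Measure Plane).prod (volume.restrict (Set.Ioi 0))) := by
  have hσ : Measurable fun p : Plane × ℝ => trigSum n c a (p.2 * p.1 i) :=
    continuous_trigSum.measurable.comp (by fun_prop)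
  have hm : Measurable (fun p : Plane × ℝ => ((p.2 ^ (-δ - 1) : ℝ) : ℂ) *
      trigSum n c a (p.2 * p.1 i) * inner ℂ (G p.1) (F p.1)) := by
    fun_prop
  refine ⟨hm.aestronglyMeasurable, ?_⟩
  rw [HasFiniteIntegral, lintegral_prod _ hm.enorm.aemeasurable]
  have hle : ∀ ξ : Plane, ∫⁻ t in Set.Ioi 0, ‖((t ^ (-δ - 1) : ℝ) : ℂ) * trigSum n c a (t * ξ i) *
      inner ℂ (G ξ) (F ξ)‖ₑ ≤ ENNReal.ofReal (B * (1 / (M - δ) + 1 / δ)) *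
        (ENNReal.ofReal (|ξ i| ^ δ) * (‖F ξ‖ₑ * ‖G ξ‖ₑ)) := by
    intro ξ
    rw [← mul_assoc]
    refine le_trans (le_of_eq ?_) (mul_le_mul_left (lintegral_rpow_mul_trigSum_le hδ hδM h1 hM _) _)
    rw [← lintegral_mul_const' _ _ (ENNReal.mul_ne_top (by simp) (by simp))]
    refine setLIntegral_congr_fun measurableSet_Ioi fun t ht => ?_
    rw [enorm_mul, enorm_mul]
    congr 2
    · rw [← ofReal_norm, Complex.norm_real, Real.norm_of_nonneg (Real.rpow_nonneg ht.le _)]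
    · simp [enorm_mul]
  refine (lintegral_mono hle).trans_lt ?_
  rw [lintegral_const_mul' _ _ ENNReal.ofReal_ne_top]
  refine ENNReal.mul_lt_top ENNReal.ofReal_lt_top ?_
  refine (lintegral_mul_le_sqrt hFm hGm (w := fun ξ => |ξ i| ^ δ) (by fun_prop)
    fun ξ => Real.rpow_nonneg (abs_nonneg _) _).trans_lt ?_
  exact ENNReal.mul_lt_top (ENNReal.rpow_lt_top_of_nonneg (by norm_num) hF)
    (ENNReal.rpow_lt_top_of_nonneg (by norm_num) hG)

/-- The identity `W = ∫ t^(-δ-1) D_t f dt` in weak form: Parseval, Fubini in `(ξ, t)`, and Parseval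
again at each fixed `t`. Tested against `Φ`, it requires absolute convergence of a scalar double
integral only, not of an `L²`-valued one. -/
theorem inner_eq_integral_lineDiff {f : Plane → ℂ}
    (hf : MemLp f 2 volume) {B M δ : ℝ} (hδ : 0 < δ) (hδM : δ < M)
    (h1 : ∀ r, ‖trigSum n c a r‖ ≤ B) (hM : ∀ r, ‖trigSum n c a r‖ ≤ B * |r| ^ M)
    (hF : ∫⁻ ξ : Plane, ENNReal.ofReal ((|ξ i| ^ δ) ^ 2) *
      ‖(𝓕 (hf.toLp f) : Lp ℂ 2 (volume : Measure Plane)) ξ‖ₑ ^ 2 ≠ ∞)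
    {W : Lp ℂ 2 (volume : Measure Plane)}
    (hW : (𝓕 W : Lp ℂ 2 (volume : Measure Plane)) =ᵐ[volume] fun ξ =>
      (∫ t in Set.Ioi 0, ((t ^ (-δ - 1) : ℝ) : ℂ) * trigSum n c a (t * ξ i)) *
        (𝓕 (hf.toLp f) : Lp ℂ 2 (volume : Measure Plane)) ξ)
    (Φ : Lp ℂ 2 (volume : Measure Plane)) :
    inner ℂ Φ W = ∫ t in Set.Ioi 0, ((t ^ (-δ - 1) : ℝ) : ℂ) *
      ∫ x, inner ℂ (Φ x) (lineDiff n c a i t f x) := by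
  have hFm : Measurable (𝓕 (hf.toLp f) : Lp ℂ 2 (volume : Measure Plane)) :=
    (Lp.stronglyMeasurable _).measurable
  have hGm : Measurable (𝓕 Φ : Lp ℂ 2 (volume : Measure Plane)) :=
    (Lp.stronglyMeasurable _).measurable
  have hG : ∫⁻ ξ : Plane, ‖(𝓕 Φ : Lp ℂ 2 (volume : Measure Plane)) ξ‖ₑ ^ 2 ≠ ∞ := by
    rw [lintegral_enorm_sq_eq_norm]
    simp
  have hint := integrable_rpow_mul_trigSum_mul hFm hGm hδ hδM h1 hM hF hG
  rw [← Lp.inner_fourier_eq, L2.inner_def]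
  calc _ = ∫ ξ, ∫ t in Set.Ioi 0, ((t ^ (-δ - 1) : ℝ) : ℂ) * trigSum n c a (t * ξ i) *
        inner ℂ ((𝓕 Φ : Lp ℂ 2 (volume : Measure Plane)) ξ)
          ((𝓕 (hf.toLp f) : Lp ℂ 2 (volume : Measure Plane)) ξ) := by
        refine integral_congr_ae ?_
        filter_upwards [hW] with ξ hξ
        rw [hξ, integral_mul_const, ← smul_eq_mul, inner_smul_right]
    _ = ∫ t in Set.Ioi 0, ∫ ξ, ((t ^ (-δ - 1) : ℝ) : ℂ) * trigSum n c a (t * ξ i) *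
        inner ℂ ((𝓕 Φ : Lp ℂ 2 (volume : Measure Plane)) ξ)
          ((𝓕 (hf.toLp f) : Lp ℂ 2 (volume : Measure Plane)) ξ) := integral_integral_swap hint
    _ = _ := by
        refine integral_congr_ae (.of_forall fun t => ?_)
        simp only [mul_assoc]
        rw [integral_const_mul]
        congr 1
        have hD := memLp_lineDiff (n := n) (c := c) (a := a) (i := i) hf t
        calc _ = inner ℂ (𝓕 Φ : Lp ℂ 2 (volume : Measure Plane)) (𝓕 (hD.toLp _)) := by
              rw [L2.inner_def]
              refine integral_congr_ae ?_
              filter_upwards [fourier_lineDiff (n := n) (c := c) (a := a) (i := i) hf t] with ξ hξ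
              rw [hξ]
              exact (inner_smul_right _ _ _).symm
          _ = _ := by
              rw [Lp.inner_fourier_eq, L2.inner_def]
              refine integral_congr_ae ?_
              filter_upwards [hD.coeFn_toLp] with x hx
              rw [hx]

/-- The weak identity becomes pointwise by duality. Testing with the phase of `W` on a set `S` of
finite measure gives `∫_S |W|` on one side; the triangle inequality and Tonelli bound the other by
the integral over `S` of the right side, and `S` is arbitrary. -/
theorem enorm_ae_le_lintegral_lineDiff {f : Plane → ℂ} (hfm : Measurable f)
    (hf : MemLp f 2 volume) {B M δ : ℝ} (hδ : 0 < δ) (hδM : δ < M)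
    (h1 : ∀ r, ‖trigSum n c a r‖ ≤ B) (hM : ∀ r, ‖trigSum n c a r‖ ≤ B * |r| ^ M)
    (hF : ∫⁻ ξ : Plane, ENNReal.ofReal ((|ξ i| ^ δ) ^ 2) *
      ‖(𝓕 (hf.toLp f) : Lp ℂ 2 (volume : Measure Plane)) ξ‖ₑ ^ 2 ≠ ∞)
    {W : Lp ℂ 2 (volume : Measure Plane)}
    (hW : (𝓕 W : Lp ℂ 2 (volume : Measure Plane)) =ᵐ[volume] fun ξ =>
      (∫ t in Set.Ioi 0, ((t ^ (-δ - 1) : ℝ) : ℂ) * trigSum n c a (t * ξ i)) *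
        (𝓕 (hf.toLp f) : Lp ℂ 2 (volume : Measure Plane)) ξ) :
    ∀ᵐ x, ‖W x‖ₑ ≤
      ∫⁻ t in Set.Ioi 0, ENNReal.ofReal (t ^ (-δ - 1)) * ‖lineDiff n c a i t f x‖ₑ := by
  have hWm : Measurable W := (Lp.stronglyMeasurable W).measurable
  have hDm := measurable_lineDiff (n := n) (c := c) (a := a) (i := i) hfm
  refine ae_le_of_forall_setLIntegral_le_of_sigmaFinite hWm.enorm fun S hS hSμ => ?_
  -- Where `W x = 0` the quotient is `0` by convention, so `|φ| ≤ 1_S` holds everywhere.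
  set φ : Plane → ℂ := S.indicator fun x => W x / ‖W x‖ with hφ
  have hφm : Measurable φ := by
    refine Measurable.indicator ?_ hS
    fun_prop
  have hφ1 : ∀ x, ‖φ x‖ₑ ≤ S.indicator (fun _ => 1) x := by
    intro x
    by_cases hx : x ∈ S
    · simp only [hφ, Set.indicator_of_mem hx]
      rw [← ofReal_norm, ENNReal.ofReal_le_one, norm_div]
      simp [div_self_le_one]
    · simp [hφ, hx]
  have hφL : MemLp φ 2 volume := by
    refine (memLp_indicator_const 2 hS (1 : ℂ) (Or.inr hSμ.ne)).mono hφm.aestronglyMeasurable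
      (.of_forall fun x => ?_)
    rw [← enorm_le_iff_norm_le]
    refine (hφ1 x).trans (le_of_eq ?_)
    by_cases hx : x ∈ S <;> simp [hx]
  have hWS : IntegrableOn (fun x => ‖W x‖) S := by
    have : IsFiniteMeasure (volume.restrict S) := ⟨by simpa using hSμ⟩
    exact ((Lp.memLp W).restrict S).integrable one_le_two |>.norm
  have e1 : ∫⁻ x in S, ‖W x‖ₑ = ‖(inner ℂ (hφL.toLp φ) W : ℂ)‖ₑ := by
    have : (inner ℂ (hφL.toLp φ) W : ℂ) = ((∫ x in S, ‖W x‖ : ℝ) : ℂ) := by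
      rw [L2.inner_def, ← integral_complex_ofReal, ← integral_indicator hS]
      refine integral_congr_ae ?_
      filter_upwards [hφL.coeFn_toLp] with x hx
      rw [hx]
      by_cases hxS : x ∈ S
      · simp only [hφ, Set.indicator_of_mem hxS]
        rcases eq_or_ne (W x) 0 with h0 | h0
        · simp [h0]
        · have h0' : (‖W x‖ : ℂ) ≠ 0 := by simpa using h0
          simp only [RCLike.inner_apply, map_div₀, Complex.conj_ofReal]
          rw [mul_div_assoc', div_eq_iff h0', Complex.mul_conj, Complex.normSq_eq_norm_sq]
          push_cast
          ring
      · simp [hφ, hxS]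
    rw [this, ← ofReal_norm, Complex.norm_real,
      Real.norm_of_nonneg (integral_nonneg fun _ => norm_nonneg _),
      ofReal_integral_eq_lintegral_ofReal hWS (.of_forall fun _ => norm_nonneg _)]
    simp only [ofReal_norm]
  rw [e1, inner_eq_integral_lineDiff hf hδ hδM h1 hM hF hW]
  calc _ ≤ ∫⁻ t in Set.Ioi 0, ‖((t ^ (-δ - 1) : ℝ) : ℂ) *
          ∫ x, inner ℂ (hφL.toLp φ x) (lineDiff n c a i t f x)‖ₑ :=
        enorm_integral_le_lintegral_enorm _
    _ ≤ ∫⁻ t in Set.Ioi 0, ∫⁻ x in S, ENNReal.ofReal (t ^ (-δ - 1)) *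
          ‖lineDiff n c a i t f x‖ₑ := by
        refine setLIntegral_mono' measurableSet_Ioi fun t ht => ?_
        rw [enorm_mul, lintegral_const_mul' _ _ ENNReal.ofReal_ne_top, ← ofReal_norm,
          Complex.norm_real, Real.norm_of_nonneg (Real.rpow_nonneg (le_of_lt ht) _)]
        refine mul_le_mul_right ((enorm_integral_le_lintegral_enorm _).trans ?_) _
        rw [← lintegral_indicator hS]
        refine lintegral_mono_ae ?_
        filter_upwards [hφL.coeFn_toLp] with x hx
        rw [hx]
        have := mul_le_mul_left (hφ1 x) ‖lineDiff n c a i t f x‖ₑ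
        by_cases hxS : x ∈ S
        · simp only [Set.indicator_of_mem hxS, one_mul] at this ⊢
          refine le_trans (le_of_eq ?_) this
          simp [enorm_mul, mul_comm]
        · simp [hφ, hxS]
    _ = _ := by
        rw [lintegral_lintegral_swap]
        exact ((by fun_prop : Measurable fun p : ℝ × Plane =>
          ENNReal.ofReal (p.1 ^ (-δ - 1))).mul (hDm.comp measurable_swap).enorm).aemeasurable

end

/-! ### The interpolation inequality for multipliers represented by differences -/

/-- Intermediate derivatives are finite because `|r|^(2δ) ≤ 1 + |r|^(2s)`. -/
theorem lintegral_rpow_mul_ne_top_of_le {F : Plane → ℂ} {i : Fin 2} {δ s : ℝ} (hδ : 0 ≤ δ)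
    (hδs : δ ≤ s) (hFm : Measurable F) (hF : ∫⁻ ξ, ‖F ξ‖ₑ ^ 2 ≠ ∞)
    (hs : ∫⁻ ξ : Plane, ENNReal.ofReal (|ξ i| ^ (2 * s)) * ‖F ξ‖ₑ ^ 2 ≠ ∞) :
    ∫⁻ ξ : Plane, ENNReal.ofReal ((|ξ i| ^ δ) ^ 2) * ‖F ξ‖ₑ ^ 2 ≠ ∞ := by
  refine ne_top_of_le_ne_top (ENNReal.add_ne_top.2 ⟨hF, hs⟩) ?_
  rw [← lintegral_add_left (by fun_prop)]
  refine lintegral_mono fun ξ => ?_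
  rw [← one_add_mul, ← ENNReal.ofReal_one, ← ENNReal.ofReal_add zero_le_one (by positivity)]
  gcongr
  rw [← Real.rpow_natCast, ← Real.rpow_mul (abs_nonneg _), mul_comm, Nat.cast_ofNat]
  rcases le_total |ξ i| 1 with h | h
  · have := Real.rpow_le_one (abs_nonneg (ξ i)) h (by positivity : 0 ≤ 2 * δ)
    have := Real.rpow_nonneg (abs_nonneg (ξ i)) (2 * s)
    linarith
  · have := Real.rpow_le_rpow_of_exponent_le h (by linarith : 2 * δ ≤ 2 * s)
    linarith

/-- The differences evaluate `f` along whole lines, so the bound by the essential supremum is needed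
at every point. Replacing `f` by `0` where it fails changes only a null set. -/
theorem exists_measurable_bounded_representative (f : Lp ℂ 2 (volume : Measure Plane)) :
    ∃ f₀ : Plane → ℂ, Measurable f₀ ∧ (∀ x, ‖f₀ x‖ₑ ≤ eLpNorm f ∞ volume) ∧
      f₀ =ᵐ[volume] f := by
  have hm : Measurable f := (Lp.stronglyMeasurable f).measurable
  refine ⟨{x | ‖f x‖ₑ ≤ eLpNorm f ∞ volume}.indicator f,
    hm.indicator (measurableSet_le hm.enorm measurable_const), fun x => ?_, ?_⟩
  · by_cases hx : x ∈ {x | ‖f x‖ₑ ≤ eLpNorm f ∞ volume}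
    · rw [Set.indicator_of_mem hx]
      exact hx
    · rw [Set.indicator_of_notMem hx, enorm_zero]
      exact bot_le
  · filter_upwards [ae_le_eLpNormEssSup (f := f) (μ := volume)] with x hx
    rw [Set.indicator_of_mem]
    simpa using hx

theorem eLpNorm_le_of_fourier_eq_integral_trigSum {n : ℕ} {c : ℕ → ℂ} {a : ℕ → ℝ} {B M δ s : ℝ}
    (hδ : 0 < δ) (hδs : δ < s) (hsM : s < M)
    (h1 : ∀ r, ‖trigSum n c a r‖ ≤ B) (hM : ∀ r, ‖trigSum n c a r‖ ≤ B * |r| ^ M) :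
    ∃ C : ℝ≥0, ∀ (i : Fin 2) (f W : Lp ℂ 2 (volume : Measure Plane)), MemLp f ∞ volume →
      ((𝓕 W : Lp ℂ 2 (volume : Measure Plane)) =ᵐ[volume] fun ξ =>
        (∫ t in Set.Ioi 0, ((t ^ (-δ - 1) : ℝ) : ℂ) * trigSum n c a (t * ξ i)) *
          (𝓕 f : Lp ℂ 2 (volume : Measure Plane)) ξ) →
      ∫⁻ ξ : Plane, ENNReal.ofReal (|ξ i| ^ (2 * s)) *
        ‖(𝓕 f : Lp ℂ 2 (volume : Measure Plane)) ξ‖ₑ ^ 2 ≠ ∞ →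
      eLpNorm W (ENNReal.ofReal (2 * s / δ)) volume ≤
        C * eLpNorm f ∞ volume ^ (1 - δ / s) *
          (∫⁻ ξ : Plane, ENNReal.ofReal (|ξ i| ^ (2 * s)) *
            ‖(𝓕 f : Lp ℂ 2 (volume : Measure Plane)) ξ‖ₑ ^ 2) ^ (δ / (2 * s)) := by
  have hs : 0 < s := hδ.trans hδs
  have hθ : 0 ≤ 1 - δ / s := by rw [sub_nonneg, div_le_one hs]; exact hδs.le
  set L : ℝ≥0∞ := ENNReal.ofReal (∑ k ∈ Finset.range n, ‖c k‖) with hL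
  set C₁ : ℝ≥0∞ := ENNReal.ofReal ((1 / (2 * (s - δ))) ^ (1 / 2 : ℝ) + 1 / δ) with hC₁
  set C₂ : ℝ≥0∞ := ENNReal.ofReal (B ^ 2 * (1 / (2 * M - 2 * s) + 1 / (2 * s))) with hC₂
  set C := C₁ * L ^ (1 - δ / s) * C₂ ^ (δ / (2 * s)) with hC
  have hCt : C ≠ ∞ := by
    refine ENNReal.mul_ne_top (ENNReal.mul_ne_top ENNReal.ofReal_ne_top ?_) ?_
    · exact ENNReal.rpow_ne_top_of_nonneg hθ ENNReal.ofReal_ne_top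
    · exact ENNReal.rpow_ne_top_of_nonneg (by positivity) ENNReal.ofReal_ne_top
  refine ⟨C.toNNReal, fun i f W hf hW hH => ?_⟩
  rw [ENNReal.coe_toNNReal hCt]
  obtain ⟨f₀, hf₀m, hf₀A, hf₀⟩ := exists_measurable_bounded_representative f
  have hf₀L : MemLp f₀ 2 volume := (Lp.memLp f).ae_eq hf₀.symm
  have hfeq : hf₀L.toLp f₀ = f := Lp.ext (hf₀L.coeFn_toLp.trans hf₀)
  set A := eLpNorm f ∞ volume with hA
  set H := ∫⁻ ξ : Plane, ENNReal.ofReal (|ξ i| ^ (2 * s)) *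
    ‖(𝓕 f : Lp ℂ 2 (volume : Measure Plane)) ξ‖ₑ ^ 2 with hHdef
  have hAt : A ≠ ∞ := hf.2.ne
  have hF : ∫⁻ ξ : Plane, ENNReal.ofReal ((|ξ i| ^ δ) ^ 2) *
      ‖(𝓕 f : Lp ℂ 2 (volume : Measure Plane)) ξ‖ₑ ^ 2 ≠ ∞ := by
    refine lintegral_rpow_mul_ne_top_of_le hδ.le hδs.le
      (Lp.stronglyMeasurable _).measurable ?_ hH
    rw [lintegral_enorm_sq_eq_norm]
    simp
  have hDm := measurable_lineDiff (n := n) (c := c) (a := a) (i := i) hf₀m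
  set Q : Plane → ℝ≥0∞ := fun x => ∫⁻ t in Set.Ioi 0, ENNReal.ofReal (t ^ (-(2 * s) - 1)) *
    ‖lineDiff n c a i t f₀ x‖ₑ ^ 2 with hQ
  have hQint : ∫⁻ x, Q x ≤ C₂ * H := by
    have := lintegral_lintegral_lineDiff_sq_le (i := i) hf₀m hf₀L hs hsM h1 hM
    rwa [hfeq] at this
  have hpt : ∀ᵐ x, ‖W x‖ₑ ≤ C₁ * (L * A) ^ (1 - δ / s) * Q x ^ (δ / (2 * s)) := by
    have := enorm_ae_le_lintegral_lineDiff (i := i) (W := W) hf₀m hf₀L hδ (hδs.trans hsM) h1 hM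
      (by rwa [hfeq]) (by rwa [hfeq])
    filter_upwards [this] with x hx
    refine hx.trans (lintegral_rpow_mul_le_interpolation
      (d := fun t => ‖lineDiff n c a i t f₀ x‖ₑ) ?_ hδ hδs
      (ENNReal.mul_ne_top ENNReal.ofReal_ne_top hAt) fun t => enorm_lineDiff_le hf₀A t x)
    exact (hDm.comp measurable_prodMk_left).enorm
  have hp : 0 < 2 * s / δ := by positivity
  rw [eLpNorm_eq_lintegral_rpow_enorm_toReal (by simpa using hp) ENNReal.ofReal_ne_top,
    ENNReal.toReal_ofReal hp.le]
  have hD0 : C₁ * (L * A) ^ (1 - δ / s) ≠ ∞ := ENNReal.mul_ne_top ENNReal.ofReal_ne_top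
    (ENNReal.rpow_ne_top_of_nonneg hθ (ENNReal.mul_ne_top ENNReal.ofReal_ne_top hAt))
  have hle : ∫⁻ x, ‖W x‖ₑ ^ (2 * s / δ) ≤
      (C₁ * (L * A) ^ (1 - δ / s)) ^ (2 * s / δ) * (C₂ * H) := by
    refine le_trans ?_ (mul_le_mul_right hQint _)
    rw [← lintegral_const_mul' _ _ (ENNReal.rpow_ne_top_of_nonneg hp.le hD0)]
    refine lintegral_mono_ae ?_
    filter_upwards [hpt] with x hx
    -- The exponent `2s/δ` is the one that turns `Q^(δ/(2s))` into `Q`, whose integral is known.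
    refine (ENNReal.rpow_le_rpow hx hp.le).trans (le_of_eq ?_)
    rw [ENNReal.mul_rpow_of_nonneg _ _ hp.le, ← ENNReal.rpow_mul (Q x),
      show δ / (2 * s) * (2 * s / δ) = 1 by field_simp, ENNReal.rpow_one]
  refine (ENNReal.rpow_le_rpow hle (by positivity)).trans (le_of_eq ?_)
  rw [ENNReal.mul_rpow_of_nonneg _ _ (by positivity), ← ENNReal.rpow_mul,
    mul_one_div_cancel hp.ne', ENNReal.rpow_one, one_div_div,
    ENNReal.mul_rpow_of_nonneg _ _ hθ, ENNReal.mul_rpow_of_nonneg C₂ _ (by positivity), hC]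
  ring

/-! ### Even and odd symbols -/

/-- Coefficients of the central difference of order `2 * m`. -/
noncomputable def centralCoeff (m k : ℕ) : ℂ := (-1) ^ (2 * m - k) * ((2 * m).choose k : ℂ)

/-- The symbol of the central difference of order `2 * m`, up to sign. -/
noncomputable def sinPow (m : ℕ) (r : ℝ) : ℝ := (2 * Real.sin (Real.pi * r)) ^ (2 * m)

/-- Binomial expansion of `(e^(iπr) - e^(-iπr))^(2m) = (2i sin(πr))^(2m)`. -/
theorem trigSum_centralCoeff (m : ℕ) (r : ℝ) :
    trigSum (2 * m + 1) (centralCoeff m) (fun k => (k : ℝ) - m) r = (-1) ^ m * (sinPow m r : ℂ) := by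
  have h2 : Complex.exp (Real.pi * r * Complex.I) + -Complex.exp (-(Real.pi * r * Complex.I)) =
      Complex.I * (2 * Complex.sin (Real.pi * r)) := by
    rw [Complex.sin, neg_mul]
    linear_combination (Complex.exp (Real.pi * r * Complex.I) -
      Complex.exp (-(Real.pi * r * Complex.I))) * Complex.I_mul_I
  have h3 : (-1 : ℂ) ^ m * (sinPow m r : ℂ) =
      (Complex.exp (Real.pi * r * Complex.I) + -Complex.exp (-(Real.pi * r * Complex.I))) ^
        (2 * m) := by
    rw [h2, mul_pow, pow_mul Complex.I, Complex.I_sq, sinPow]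
    push_cast
    rfl
  rw [h3, add_pow, trigSum]
  refine Finset.sum_congr rfl fun k hk => ?_
  have hk' : k ≤ 2 * m := Nat.lt_succ_iff.1 (Finset.mem_range.1 hk)
  rw [neg_pow (Complex.exp _), ← Complex.exp_nat_mul, ← Complex.exp_nat_mul, centralCoeff]
  have h4 : Complex.exp (2 * Real.pi * Complex.I * (((k : ℝ) - m) * r : ℝ)) =
      Complex.exp (k * (Real.pi * r * Complex.I)) *
        Complex.exp ((2 * m - k : ℕ) * -(Real.pi * r * Complex.I)) := by
    rw [← Complex.exp_add]
    congr 1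
    push_cast [Nat.cast_sub hk']
    ring
  rw [h4]
  ring

theorem abs_two_mul_sin_le_two (r : ℝ) : |2 * Real.sin (Real.pi * r)| ≤ 2 := by
  rw [abs_mul, abs_two]
  linarith [Real.abs_sin_le_one (Real.pi * r)]

theorem abs_two_mul_sin_le (r : ℝ) : |2 * Real.sin (Real.pi * r)| ≤ 2 * Real.pi * |r| := by
  rw [abs_mul, abs_two, mul_assoc, ← abs_of_pos Real.pi_pos, ← abs_mul, abs_of_pos Real.pi_pos]
  linarith [Real.abs_sin_le_abs (x := Real.pi * r)]

/-- The interpolation lemmas use one constant `B` both for the uniform bound and for the bound near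
`0`. This inequality lets a power of `2π` serve for both. -/
theorem two_pow_le_two_pi_pow (k : ℕ) : (2 : ℝ) ^ k ≤ (2 * Real.pi) ^ k :=
  pow_le_pow_left₀ zero_le_two (by linarith [Real.pi_gt_three]) k

theorem norm_centralSymbol_le (m : ℕ) (r : ℝ) :
    ‖trigSum (2 * m + 1) (centralCoeff m) (fun k => (k : ℝ) - m) r‖ ≤ (2 * Real.pi) ^ (2 * m) := by
  rw [trigSum_centralCoeff, norm_mul, norm_pow, norm_neg, norm_one, one_pow, one_mul,
    Complex.norm_real, sinPow, norm_pow]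
  exact (pow_le_pow_left₀ (norm_nonneg _) (abs_two_mul_sin_le_two r) _).trans
    (two_pow_le_two_pi_pow _)

theorem norm_centralSymbol_le_rpow (m : ℕ) (r : ℝ) :
    ‖trigSum (2 * m + 1) (centralCoeff m) (fun k => (k : ℝ) - m) r‖ ≤
      (2 * Real.pi) ^ (2 * m) * |r| ^ ((2 * m : ℕ) : ℝ) := by
  rw [trigSum_centralCoeff, norm_mul, norm_pow, norm_neg, norm_one, one_pow, one_mul,
    Complex.norm_real, sinPow, norm_pow, Real.rpow_natCast, ← mul_pow]
  exact pow_le_pow_left₀ (norm_nonneg _) (abs_two_mul_sin_le r) _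

/-! ### The odd symbol as the derivative of the even one. -/

theorem hasDerivAt_trigSum (n : ℕ) (c : ℕ → ℂ) (a : ℕ → ℝ) (r : ℝ) :
    HasDerivAt (trigSum n c a)
      (trigSum n (fun k => c k * (2 * Real.pi * Complex.I * a k)) a r) r := by
  unfold trigSum
  refine HasDerivAt.fun_sum fun k _ => ?_
  have h : HasDerivAt (fun x : ℝ => (2 * Real.pi * Complex.I * (a k * x : ℝ) : ℂ))
      (2 * Real.pi * Complex.I * a k) r := by
    have h0 : HasDerivAt (fun x : ℝ => ((a k * x : ℝ) : ℂ)) (a k : ℂ) r := by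
      simpa using ((hasDerivAt_id r).const_mul (a k)).ofReal_comp
    exact h0.const_mul _
  convert! (h.cexp.const_mul (c k)) using 1
  ring

theorem hasDerivAt_sinPow (j : ℕ) (r : ℝ) :
    HasDerivAt (sinPow (j + 1)) ((2 * (j + 1)) * (2 * Real.sin (Real.pi * r)) ^ (2 * j + 1) *
      (2 * (Real.pi * Real.cos (Real.pi * r)))) r := by
  have h : HasDerivAt (fun x => 2 * Real.sin (Real.pi * x))
      (2 * (Real.pi * Real.cos (Real.pi * r))) r := by
    have := (((hasDerivAt_id r).const_mul Real.pi).sin).const_mul 2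
    simpa [mul_comm] using this
  convert! h.pow (2 * (j + 1)) using 1
  push_cast
  rfl

/-- Coefficients of the derivative of the central difference symbol. -/
noncomputable def oddCoeff (m k : ℕ) : ℂ :=
  centralCoeff m k * (2 * Real.pi * Complex.I * ((k : ℝ) - m : ℝ))

/-- Both sides are the derivative at `r` of the central symbol, once as an exponential sum and once
in closed form. The index `j + 1` keeps the exponent `2 * j + 1` free of subtraction. -/
theorem trigSum_oddCoeff (j : ℕ) (r : ℝ) :
    trigSum (2 * (j + 1) + 1) (oddCoeff (j + 1)) (fun k => (k : ℝ) - (j + 1 : ℕ)) r =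
      (-1) ^ (j + 1) * (((2 * (j + 1)) * (2 * Real.sin (Real.pi * r)) ^ (2 * j + 1) *
      (2 * (Real.pi * Real.cos (Real.pi * r))) : ℝ) : ℂ) := by
  have h1 := hasDerivAt_trigSum (2 * (j + 1) + 1) (centralCoeff (j + 1))
    (fun k => (k : ℝ) - (j + 1 : ℕ)) r
  have h2 := ((hasDerivAt_sinPow j r).ofReal_comp).const_mul ((-1 : ℂ) ^ (j + 1))
  refine h1.unique (h2.congr_of_eventuallyEq (.of_forall fun x => ?_))
  exact trigSum_centralCoeff (j + 1) x

theorem norm_oddSymbol (j : ℕ) (r : ℝ) :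
    ‖trigSum (2 * (j + 1) + 1) (oddCoeff (j + 1)) (fun k => (k : ℝ) - (j + 1 : ℕ)) r‖ ≤
      4 * Real.pi * (j + 1) * |2 * Real.sin (Real.pi * r)| ^ (2 * j + 1) := by
  rw [trigSum_oddCoeff, norm_mul, norm_pow, norm_neg, norm_one, one_pow, one_mul,
    Complex.norm_real, Real.norm_eq_abs, abs_mul, abs_mul, abs_pow, abs_mul 2 (Real.pi * _),
    abs_mul Real.pi, abs_two, abs_of_pos Real.pi_pos, abs_of_pos (by positivity)]
  have := Real.abs_cos_le_one (Real.pi * r)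
  have h0 : 0 ≤ 2 * ((j : ℝ) + 1) * |2 * Real.sin (Real.pi * r)| ^ (2 * j + 1) *
    (2 * Real.pi) := by positivity
  nlinarith [mul_le_mul_of_nonneg_left this h0]

theorem norm_oddSymbol_le (j : ℕ) (r : ℝ) :
    ‖trigSum (2 * (j + 1) + 1) (oddCoeff (j + 1)) (fun k => (k : ℝ) - (j + 1 : ℕ)) r‖ ≤
      4 * Real.pi * (j + 1) * (2 * Real.pi) ^ (2 * j + 1) := by
  refine (norm_oddSymbol j r).trans (mul_le_mul_of_nonneg_left ?_ (by positivity))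
  exact (pow_le_pow_left₀ (abs_nonneg _) (abs_two_mul_sin_le_two r) _).trans
    (two_pow_le_two_pi_pow _)

theorem norm_oddSymbol_le_rpow (j : ℕ) (r : ℝ) :
    ‖trigSum (2 * (j + 1) + 1) (oddCoeff (j + 1)) (fun k => (k : ℝ) - (j + 1 : ℕ)) r‖ ≤
      4 * Real.pi * (j + 1) * (2 * Real.pi) ^ (2 * j + 1) * |r| ^ ((2 * j + 1 : ℕ) : ℝ) := by
  refine (norm_oddSymbol j r).trans ?_
  rw [mul_assoc (4 * Real.pi * (j + 1)) _ (|r| ^ _), Real.rpow_natCast, ← mul_pow]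
  refine mul_le_mul_of_nonneg_left ?_ (by positivity)
  exact pow_le_pow_left₀ (abs_nonneg _) (abs_two_mul_sin_le r) _

/-! ### The multipliers represented by the symbols -/

theorem integral_rpow_mul_comp_mul (σ : ℝ → ℂ) (δ : ℝ) {b : ℝ} (hb : 0 < b) :
    ∫ t in Set.Ioi 0, ((t ^ (-δ - 1) : ℝ) : ℂ) * σ (t * b) =
      ((b ^ δ : ℝ) : ℂ) * ∫ t in Set.Ioi 0, ((t ^ (-δ - 1) : ℝ) : ℂ) * σ t := by
  have h := integral_comp_mul_right_Ioi (fun t : ℝ => ((t ^ (-δ - 1) : ℝ) : ℂ) * σ t) 0 hb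
  rw [zero_mul] at h
  -- Write `t^(-δ-1) = b^(δ+1) (t b)^(-δ-1)`, so that the integrand is a function of `t b`.
  have h' : ∫ t in Set.Ioi 0, ((t ^ (-δ - 1) : ℝ) : ℂ) * σ (t * b) =
      ((b ^ (δ + 1) : ℝ) : ℂ) * ∫ t in Set.Ioi 0, (((t * b) ^ (-δ - 1) : ℝ) : ℂ) * σ (t * b) := by
    rw [← integral_const_mul]
    refine setIntegral_congr_fun measurableSet_Ioi fun t ht => ?_
    rw [← mul_assoc, ← Complex.ofReal_mul, Real.mul_rpow (le_of_lt ht) hb.le,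
      mul_left_comm, ← Real.rpow_add hb, show δ + 1 + (-δ - 1) = 0 by ring, Real.rpow_zero, mul_one]
  rw [h', h, Complex.real_smul, ← mul_assoc, ← Complex.ofReal_mul, Real.rpow_add hb, Real.rpow_one,
    mul_assoc, mul_inv_cancel₀ hb.ne', mul_one]

theorem integrableOn_rpow_mul_trigSum {n : ℕ} {c : ℕ → ℂ} {a : ℕ → ℝ} {B M δ : ℝ} (hδ : 0 < δ)
    (hδM : δ < M) (h1 : ∀ r, ‖trigSum n c a r‖ ≤ B) (hM : ∀ r, ‖trigSum n c a r‖ ≤ B * |r| ^ M) :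
    IntegrableOn (fun t : ℝ => ((t ^ (-δ - 1) : ℝ) : ℂ) * trigSum n c a t) (Set.Ioi 0) := by
  have hσ : Measurable (trigSum n c a) := continuous_trigSum.measurable
  refine ⟨Measurable.aestronglyMeasurable (by fun_prop), ?_⟩
  rw [HasFiniteIntegral]
  have h := lintegral_rpow_mul_trigSum_le hδ hδM h1 hM 1
  refine lt_of_le_of_lt (le_of_eq ?_) (h.trans_lt (by
    exact ENNReal.mul_lt_top ENNReal.ofReal_lt_top ENNReal.ofReal_lt_top))
  refine setLIntegral_congr_fun measurableSet_Ioi fun t ht => ?_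
  rw [enorm_mul, mul_one, ← ofReal_norm ((_ : ℝ) : ℂ), Complex.norm_real,
    Real.norm_of_nonneg (Real.rpow_nonneg (le_of_lt ht) _)]

/-- The constant relating `|ξ| ^ δ` to the central difference of order `2 * m`. -/
noncomputable def centralConst (m : ℕ) (δ : ℝ) : ℂ :=
  ∫ t in Set.Ioi 0, ((t ^ (-δ - 1) : ℝ) : ℂ) *
    trigSum (2 * m + 1) (centralCoeff m) (fun k => (k : ℝ) - m) t

/-- Up to the sign `(-1)^m` the integrand is nonnegative, and it is positive on `(0, 1)`. -/
theorem centralConst_ne_zero {m : ℕ} {δ : ℝ} (hδ : 0 < δ) (hm : δ < (2 * m : ℕ)) :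
    centralConst m δ ≠ 0 := by
  have hint := integrableOn_rpow_mul_trigSum hδ hm (norm_centralSymbol_le m)
    (norm_centralSymbol_le_rpow m)
  have hpt : ∀ t : ℝ, ((t ^ (-δ - 1) : ℝ) : ℂ) *
      trigSum (2 * m + 1) (centralCoeff m) (fun k => (k : ℝ) - m) t =
      (-1) ^ m * ((t ^ (-δ - 1) * sinPow m t : ℝ) : ℂ) := by
    intro t
    rw [trigSum_centralCoeff]
    push_cast
    ring
  have hsin : ∀ t, 0 ≤ sinPow m t := fun t => by
    rw [sinPow, pow_mul]
    positivity
  simp only [centralConst, hpt] at hint ⊢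
  rw [integral_const_mul, integral_complex_ofReal]
  refine mul_ne_zero (pow_ne_zero _ (by norm_num)) (Complex.ofReal_ne_zero.2 (ne_of_gt ?_))
  have hint' : IntegrableOn (fun t : ℝ => t ^ (-δ - 1) * sinPow m t) (Set.Ioi 0) := by
    refine (hint.norm).congr ?_
    filter_upwards [ae_restrict_mem measurableSet_Ioi] with t ht
    rw [norm_mul, norm_pow, norm_neg, norm_one, one_pow, one_mul, Complex.norm_real,
      Real.norm_of_nonneg (mul_nonneg (Real.rpow_nonneg (le_of_lt ht) _) (hsin t))]
  rw [integral_pos_iff_support_of_nonneg_ae _ hint']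
  · rw [Measure.restrict_apply' measurableSet_Ioi]
    refine lt_of_lt_of_le (b := volume (Set.Ioo (0 : ℝ) 1)) (by simp) (measure_mono ?_)
    intro t ht
    refine ⟨?_, ht.1⟩
    rw [Function.mem_support]
    have : 0 < Real.sin (Real.pi * t) := Real.sin_pos_of_pos_of_lt_pi
      (mul_pos Real.pi_pos ht.1) (by nlinarith [Real.pi_pos, ht.2])
    have h2 := Real.rpow_pos_of_pos ht.1 (-δ - 1)
    rw [sinPow]
    positivity
  · filter_upwards [ae_restrict_mem measurableSet_Ioi] with t ht
    exact mul_nonneg (Real.rpow_nonneg (le_of_lt ht) _) (hsin t)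

theorem integral_centralSymbol {m : ℕ} (hm : m ≠ 0) {δ : ℝ} (hδ : 0 < δ) (r : ℝ) :
    ∫ t in Set.Ioi 0, ((t ^ (-δ - 1) : ℝ) : ℂ) *
      trigSum (2 * m + 1) (centralCoeff m) (fun k => (k : ℝ) - m) (t * r) =
      ((|r| ^ δ : ℝ) : ℂ) * centralConst m δ := by
  have heven : ∀ t, trigSum (2 * m + 1) (centralCoeff m) (fun k => (k : ℝ) - m) (t * r) =
      trigSum (2 * m + 1) (centralCoeff m) (fun k => (k : ℝ) - m) (t * |r|) := by
    intro t
    rcases abs_choice r with h | h <;> rw [h]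
    rw [trigSum_centralCoeff, trigSum_centralCoeff, sinPow, sinPow, mul_neg, mul_neg, Real.sin_neg,
      mul_neg, (even_two_mul m).neg_pow]
  simp only [heven]
  rcases eq_or_ne r 0 with rfl | hr
  · simp [trigSum_centralCoeff, sinPow, hm, Real.zero_rpow hδ.ne']
  · exact integral_rpow_mul_comp_mul _ δ (abs_pos.2 hr)

/-- The constant relating `ξ` to the odd difference. -/
noncomputable def oddConst (j : ℕ) : ℂ :=
  ∫ t in Set.Ioi 0, ((t ^ (-1 - 1 : ℝ) : ℝ) : ℂ) *
    trigSum (2 * (j + 1) + 1) (oddCoeff (j + 1)) (fun k => (k : ℝ) - (j + 1 : ℕ)) t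

theorem integral_oddSymbol (j : ℕ) (r : ℝ) :
    ∫ t in Set.Ioi 0, ((t ^ (-1 - 1 : ℝ) : ℝ) : ℂ) *
      trigSum (2 * (j + 1) + 1) (oddCoeff (j + 1)) (fun k => (k : ℝ) - (j + 1 : ℕ)) (t * r) =
      r * oddConst j := by
  have hpos : ∀ b : ℝ, 0 < b → ∫ t in Set.Ioi 0, ((t ^ (-1 - 1 : ℝ) : ℝ) : ℂ) *
      trigSum (2 * (j + 1) + 1) (oddCoeff (j + 1)) (fun k => (k : ℝ) - (j + 1 : ℕ)) (t * b) =
      b * oddConst j := by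
    intro b hb
    rw [integral_rpow_mul_comp_mul _ 1 hb, Real.rpow_one]
    rfl
  rcases lt_trichotomy r 0 with hr | rfl | hr
  · have hodd : ∀ t,
        trigSum (2 * (j + 1) + 1) (oddCoeff (j + 1)) (fun k => (k : ℝ) - (j + 1 : ℕ)) (t * r) =
        -trigSum (2 * (j + 1) + 1) (oddCoeff (j + 1)) (fun k => (k : ℝ) - (j + 1 : ℕ))
          (t * -r) := by
      intro t
      rw [trigSum_oddCoeff, trigSum_oddCoeff, mul_neg, mul_neg, Real.sin_neg, Real.cos_neg,
        mul_neg, Odd.neg_pow ⟨j, rfl⟩]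
      push_cast
      ring
    simp only [hodd, mul_neg, integral_neg]
    simp only [← mul_neg, hpos (-r) (neg_pos.2 hr)]
    push_cast
    ring
  · simp only [mul_zero, trigSum_oddCoeff]
    simp
  · exact hpos r hr

/-- The odd symbol changes sign, so its integral is not visibly nonzero. Integrating `t^(-2) v'` by
parts gives `2 ∫ t^(-3) v`, with `v` the central symbol, which has a fixed sign. -/
theorem oddConst_eq {j : ℕ} (hj : j ≠ 0) : oddConst j = 2 * centralConst (j + 1) 2 := by
  set v := trigSum (2 * (j + 1) + 1) (centralCoeff (j + 1)) (fun k => (k : ℝ) - (j + 1 : ℕ)) with hv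
  have hj1 : (1 : ℝ) ≤ j := by exact_mod_cast Nat.one_le_iff_ne_zero.2 hj
  have hb1 := norm_centralSymbol_le (j + 1)
  have hbM := norm_centralSymbol_le_rpow (j + 1)
  have key := integral_Ioi_mul_deriv_eq_deriv_mul (a := 0) (a' := (0 : ℂ)) (b' := 0)
    (u := fun t : ℝ => ((t ^ (-1 - 1 : ℝ) : ℝ) : ℂ)) (v := v)
    (u' := fun t : ℝ => -2 * ((t ^ (-2 - 1 : ℝ) : ℝ) : ℂ))
    (v' := trigSum (2 * (j + 1) + 1) (oddCoeff (j + 1)) (fun k => (k : ℝ) - (j + 1 : ℕ)))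
    ?_ ?_ ?_ ?_ ?_ ?_
  · rw [oddConst, key, centralConst]
    simp only [mul_assoc, integral_const_mul]
    ring
  · intro t ht
    have h := (Real.hasDerivAt_rpow_const (x := t) (p := -1 - 1) (Or.inl (ne_of_gt ht))).ofReal_comp
    convert! h using 1
    push_cast
    norm_num
  · intro t _
    exact hasDerivAt_trigSum _ _ _ t
  · exact integrableOn_rpow_mul_trigSum one_pos (M := (2 * j + 1 : ℕ)) (by push_cast; linarith)
      (norm_oddSymbol_le j) (norm_oddSymbol_le_rpow j)
  · have h := (integrableOn_rpow_mul_trigSum two_pos (by push_cast; linarith) hb1 hbM).const_mul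
      (-2 : ℂ)
    refine h.congr (.of_forall fun t => ?_)
    simp [hv, mul_assoc]
  -- The boundary term at `0` is `O(t^(2j))`, which tends to `0` because `j ≠ 0`.
  · have hb : ∀ t ∈ Set.Ioi (0 : ℝ), ‖((fun t : ℝ => ((t ^ (-1 - 1 : ℝ) : ℝ) : ℂ)) * v) t‖ ≤
        (2 * Real.pi) ^ (2 * (j + 1)) * t ^ (2 * j) := by
      intro t ht
      have ht : 0 < t := ht
      have h0 := hbM t
      rw [abs_of_pos ht] at h0
      rw [Pi.mul_apply, norm_mul, Complex.norm_real, Real.norm_of_nonneg (by positivity)]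
      refine (mul_le_mul_of_nonneg_left h0 (by positivity)).trans (le_of_eq ?_)
      rw [mul_left_comm, ← Real.rpow_add ht, ← Real.rpow_natCast t (2 * j)]
      congr 2
      push_cast
      ring
    refine squeeze_zero_norm' (eventually_nhdsWithin_of_forall hb) ?_
    refine Filter.Tendsto.mono_left ?_ nhdsWithin_le_nhds
    have : Continuous fun t : ℝ => (2 * Real.pi) ^ (2 * (j + 1)) * t ^ (2 * j) := by fun_prop
    simpa [hj] using this.tendsto 0
  -- At infinity `v` is bounded and `t^(-2)` decays.
  · refine squeeze_zero_norm' (a := fun t : ℝ => t ^ (-2 : ℝ) * (2 * Real.pi) ^ (2 * (j + 1))) ?_ ?_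
    · filter_upwards [Filter.eventually_gt_atTop 0] with t ht
      rw [Pi.mul_apply, norm_mul, Complex.norm_real, Real.norm_of_nonneg (by positivity)]
      rw [show (-1 - 1 : ℝ) = -2 by norm_num]
      exact mul_le_mul_of_nonneg_left (hb1 t) (by positivity)
    · simpa using (tendsto_rpow_neg_atTop two_pos).mul_const ((2 * Real.pi) ^ (2 * (j + 1)))

theorem oddConst_ne_zero {j : ℕ} (hj : j ≠ 0) : oddConst j ≠ 0 := by
  have hj1 : (1 : ℝ) ≤ j := by exact_mod_cast Nat.one_le_iff_ne_zero.2 hj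
  rw [oddConst_eq hj]
  exact mul_ne_zero two_ne_zero (centralConst_ne_zero two_pos (by push_cast; linarith))

/-! ### Fourier multipliers in one coordinate acting on `L²` -/

/-- `IsLambda` only asserts that some function represents `𝓕 (∂f)`; uniqueness almost everywhere
identifies it with `2πi ξ_i 𝓕 f`. -/
theorem fourier_ae_eq_of_isLambda_partialD {i : Fin 2} {ϱ : ℝ}
    {f h : Lp ℂ 2 (volume : Measure Plane)}
    (hfh : IsLambda i ϱ (partialD i (f : 𝓢'(Plane, ℂ))) (h : 𝓢'(Plane, ℂ))) :
    (𝓕 h : Lp ℂ 2 (volume : Measure Plane)) =ᵐ[volume] fun ξ =>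
      ((|2 * Real.pi * ξ i| ^ ϱ : ℝ) : ℂ) * (2 * Real.pi * Complex.I * ξ i *
        (𝓕 f : Lp ℂ 2 (volume : Measure Plane)) ξ) := by
  obtain ⟨b, hb, hb'⟩ := hfh
  filter_upwards [hb.ae_eq (isGivenBy_fourier_partialD i f), (isGivenBy_fourier_Lp h).ae_eq hb']
    with ξ h1 h2
  rw [h2, h1]

theorem eLpNorm_two_sq_eq (g : Lp ℂ 2 (volume : Measure Plane)) :
    eLpNorm g 2 volume ^ 2 =
      ∫⁻ ξ, ‖(𝓕 g : Lp ℂ 2 (volume : Measure Plane)) ξ‖ₑ ^ 2 := by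
  rw [lintegral_fourier_enorm_sq, lintegral_enorm_sq_eq_norm, Lp.enorm_def]

/-- The `L²` norm of `Λ^ϱ ∂ f` is the homogeneous Sobolev norm of order `ϱ + 1` of `f`. -/
theorem eLpNorm_sq_of_isLambda_partialD {i : Fin 2} {ϱ : ℝ} (hϱ : -1 < ϱ)
    {f h : Lp ℂ 2 (volume : Measure Plane)}
    (hfh : IsLambda i ϱ (partialD i (f : 𝓢'(Plane, ℂ))) (h : 𝓢'(Plane, ℂ))) :
    eLpNorm h 2 volume ^ 2 = ∫⁻ ξ : Plane, ENNReal.ofReal (|2 * Real.pi * ξ i| ^ (2 * (ϱ + 1))) *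
      ‖(𝓕 f : Lp ℂ 2 (volume : Measure Plane)) ξ‖ₑ ^ 2 := by
  rw [eLpNorm_two_sq_eq]
  refine lintegral_congr_ae ?_
  filter_upwards [fourier_ae_eq_of_isLambda_partialD hfh] with ξ hξ
  rw [hξ, ← mul_assoc, enorm_mul, mul_pow]
  congr 1
  rw [← ofReal_norm, ← ENNReal.ofReal_pow (norm_nonneg _)]
  congr 1
  have e : ‖((|2 * Real.pi * ξ i| ^ ϱ : ℝ) : ℂ) * (2 * Real.pi * Complex.I * ξ i)‖ =
      |2 * Real.pi * ξ i| ^ ϱ * |2 * Real.pi * ξ i| := by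
    rw [norm_mul, Complex.norm_real, Real.norm_of_nonneg (by positivity)]
    congr 1
    simp [abs_mul]
  rw [e]
  -- For `ξ i = 0` the factor coming from `∂` makes the left side vanish, whatever value `0 ^ ϱ`
  -- has; the right side vanishes because `ϱ + 1 ≠ 0`.
  rcases eq_or_ne (ξ i) 0 with h0 | h0
  · simp [h0, Real.zero_rpow (by linarith : 2 * (ϱ + 1) ≠ 0)]
  · have hx : 0 < |2 * Real.pi * ξ i| :=
      abs_pos.2 (mul_ne_zero (by positivity) h0)
    rw [← Real.rpow_add_one hx.ne', ← Real.rpow_natCast, ← Real.rpow_mul hx.le,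
      mul_comm (ϱ + 1), Nat.cast_ofNat]

theorem lintegral_rpow_le_eLpNorm_sq {i : Fin 2} {ϱ : ℝ} (hϱ : -1 < ϱ)
    {f h : Lp ℂ 2 (volume : Measure Plane)}
    (hfh : IsLambda i ϱ (partialD i (f : 𝓢'(Plane, ℂ))) (h : 𝓢'(Plane, ℂ))) :
    ∫⁻ ξ : Plane, ENNReal.ofReal (|ξ i| ^ (2 * (ϱ + 1))) *
      ‖(𝓕 f : Lp ℂ 2 (volume : Measure Plane)) ξ‖ₑ ^ 2 ≤ eLpNorm h 2 volume ^ 2 := by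
  rw [eLpNorm_sq_of_isLambda_partialD hϱ hfh]
  refine lintegral_mono fun ξ => ?_
  have h : |ξ i| ≤ |2 * Real.pi * ξ i| := by
    rw [abs_mul, abs_of_pos (by positivity : 0 < 2 * Real.pi)]
    exact le_mul_of_one_le_left (abs_nonneg _) (by linarith [Real.pi_gt_three])
  exact mul_le_mul_left (ENNReal.ofReal_le_ofReal
    (Real.rpow_le_rpow (abs_nonneg _) h (by linarith))) _

/-- A multiplier in the variable `ξ i` of size `|ξ i| ^ δ` is defined on `f ∈ L²` with values in
`L²` if `f` has `s ≥ δ` derivatives in `L²` in direction `x_i`. -/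
theorem exists_Lp_fourier_eq {i : Fin 2} {δ s K : ℝ} (hδ : 0 ≤ δ) (hδs : δ ≤ s) {μ : ℝ → ℂ}
    (hμm : Measurable μ) (hμ : ∀ r, ‖μ r‖ ≤ K * |r| ^ δ)
    {f : Lp ℂ 2 (volume : Measure Plane)}
    (hf : ∫⁻ ξ : Plane, ENNReal.ofReal (|ξ i| ^ (2 * s)) *
      ‖(𝓕 f : Lp ℂ 2 (volume : Measure Plane)) ξ‖ₑ ^ 2 ≠ ∞) :
    ∃ W : Lp ℂ 2 (volume : Measure Plane),
      (𝓕 W : Lp ℂ 2 (volume : Measure Plane)) =ᵐ[volume] fun ξ =>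
        μ (ξ i) * (𝓕 f : Lp ℂ 2 (volume : Measure Plane)) ξ := by
  have hFm : Measurable (𝓕 f : Lp ℂ 2 (volume : Measure Plane)) :=
    (Lp.stronglyMeasurable _).measurable
  have hF : ∫⁻ ξ, ‖(𝓕 f : Lp ℂ 2 (volume : Measure Plane)) ξ‖ₑ ^ 2 ≠ ∞ := by
    rw [lintegral_enorm_sq_eq_norm]
    simp
  have hfin := lintegral_rpow_mul_ne_top_of_le hδ hδs hFm hF hf
  have hL : MemLp (fun ξ : Plane => μ (ξ i) * (𝓕 f : Lp ℂ 2 (volume : Measure Plane)) ξ) 2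
      volume := by
    refine ⟨Measurable.aestronglyMeasurable (by fun_prop), ?_⟩
    rw [eLpNorm_lt_top_iff_lintegral_rpow_enorm_lt_top two_ne_zero ENNReal.ofNat_ne_top]
    simp only [ENNReal.toReal_ofNat, ENNReal.rpow_two]
    refine lt_of_le_of_lt ?_ (ENNReal.mul_lt_top (ENNReal.ofReal_lt_top (r := K ^ 2)) hfin.lt_top)
    rw [← lintegral_const_mul' _ _ ENNReal.ofReal_ne_top]
    refine lintegral_mono fun ξ => ?_
    rw [enorm_mul, mul_pow, ← mul_assoc, ← ENNReal.ofReal_mul (sq_nonneg K), ← mul_pow K,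
      ← ofReal_norm (μ _), ← ENNReal.ofReal_pow (norm_nonneg _)]
    gcongr
    exact hμ _
  refine ⟨𝓕⁻ (hL.toLp _), ?_⟩
  rw [FourierTransform.fourier_fourierInv_eq]
  exact hL.coeFn_toLp

/-- Plancherel for the endpoint `δ = ϱ + 1`, where the target exponent is `2` and the interpolation
constant in `1 / (s - δ)` breaks down. -/
theorem eLpNorm_two_eq_of_norm_multiplier_eq {i : Fin 2} {ϱ : ℝ} (hϱ : -1 < ϱ) {μ : ℝ → ℂ}
    (hμ : ∀ r, ‖μ r‖ = |2 * Real.pi * r| ^ (ϱ + 1)) {f h W : Lp ℂ 2 (volume : Measure Plane)}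
    (hfh : IsLambda i ϱ (partialD i (f : 𝓢'(Plane, ℂ))) (h : 𝓢'(Plane, ℂ)))
    (hW : (𝓕 W : Lp ℂ 2 (volume : Measure Plane)) =ᵐ[volume] fun ξ =>
        μ (ξ i) * (𝓕 f : Lp ℂ 2 (volume : Measure Plane)) ξ) :
    eLpNorm W 2 volume = eLpNorm h 2 volume := by
  have : eLpNorm W 2 volume ^ 2 = eLpNorm h 2 volume ^ 2 := by
    rw [eLpNorm_sq_of_isLambda_partialD hϱ hfh, eLpNorm_two_sq_eq]
    refine lintegral_congr_ae ?_
    filter_upwards [hW] with ξ hξ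
    rw [hξ, enorm_mul, mul_pow, ← ofReal_norm, ← ENNReal.ofReal_pow (norm_nonneg _), hμ,
      ← Real.rpow_natCast, ← Real.rpow_mul (abs_nonneg _), mul_comm (ϱ + 1), Nat.cast_ofNat]
  exact (ENNReal.pow_right_strictMono two_ne_zero).injective this

/-- The interpolation inequality for a multiplier proportional to an integral of difference
symbols. -/
theorem eLpNorm_le_of_multiplier_eq {n : ℕ} {c : ℕ → ℂ} {a : ℕ → ℝ} {B M δ ϱ : ℝ}
    (hδ : 0 < δ) (hδs : δ < ϱ + 1) (hsM : ϱ + 1 < M)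
    (h1 : ∀ r, ‖trigSum n c a r‖ ≤ B) (hM : ∀ r, ‖trigSum n c a r‖ ≤ B * |r| ^ M)
    {μ : ℝ → ℂ} {κ : ℂ} (hμ : ∀ r, μ r = κ *
      ∫ t in Set.Ioi 0, ((t ^ (-δ - 1) : ℝ) : ℂ) * trigSum n c a (t * r)) :
    ∃ C : ℝ≥0, ∀ (i : Fin 2) (f h W : Lp ℂ 2 (volume : Measure Plane)), MemLp f ∞ volume →
      IsLambda i ϱ (partialD i (f : 𝓢'(Plane, ℂ))) (h : 𝓢'(Plane, ℂ)) →
      ((𝓕 W : Lp ℂ 2 (volume : Measure Plane)) =ᵐ[volume] fun ξ =>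
        μ (ξ i) * (𝓕 f : Lp ℂ 2 (volume : Measure Plane)) ξ) →
      eLpNorm W (ENNReal.ofReal (2 * (ϱ + 1) / δ)) volume ≤
        C * eLpNorm f ∞ volume ^ (1 - δ / (ϱ + 1)) *
          eLpNorm h 2 volume ^ (δ / (ϱ + 1)) := by
  have hsmul : ∀ r, trigSum n (fun k => κ * c k) a r = κ * trigSum n c a r := fun r => by
    simp only [trigSum, Finset.mul_sum, mul_assoc]
  -- The factor `κ` is absorbed into the coefficients of the difference.
  obtain ⟨C, hC⟩ := eLpNorm_le_of_fourier_eq_integral_trigSum (n := n) (c := fun k => κ * c k)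
    (a := a) (B := ‖κ‖ * B) hδ hδs hsM
    (fun r => by
      rw [hsmul, norm_mul]
      exact mul_le_mul_of_nonneg_left (h1 r) (norm_nonneg _))
    (fun r => by
      rw [hsmul, norm_mul, mul_assoc]
      exact mul_le_mul_of_nonneg_left (hM r) (norm_nonneg _))
  have hs : 0 < ϱ + 1 := hδ.trans hδs
  refine ⟨C, fun i f h W hf hfh hW => ?_⟩
  have hle := lintegral_rpow_le_eLpNorm_sq (by linarith) hfh
  refine (hC i f W hf ?_ (ne_top_of_le_ne_top
    (ENNReal.pow_ne_top (Lp.memLp h).2.ne) hle)).trans ?_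
  · filter_upwards [hW] with ξ hξ
    rw [hξ, hμ, ← integral_const_mul]
    congr 2
    ext t
    rw [hsmul]
    ring
  · refine mul_le_mul_right ((ENNReal.rpow_le_rpow hle (by positivity)).trans (le_of_eq ?_)) _
    rw [← ENNReal.rpow_two, ← ENNReal.rpow_mul]
    congr 1
    field_simp

theorem isGivenBy_partialD_of_fourier_eq {i : Fin 2} {f W : Lp ℂ 2 (volume : Measure Plane)}
    (hW : (𝓕 W : Lp ℂ 2 (volume : Measure Plane)) =ᵐ[volume] fun ξ =>
        2 * Real.pi * Complex.I * ξ i * (𝓕 f : Lp ℂ 2 (volume : Measure Plane)) ξ) :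
    IsGivenBy (partialD i (f : 𝓢'(Plane, ℂ))) W := by
  have h : 𝓕 (partialD i (f : 𝓢'(Plane, ℂ))) = 𝓕 (W : 𝓢'(Plane, ℂ)) :=
    (isGivenBy_fourier_partialD i f).distribution_eq ((isGivenBy_fourier_Lp W).congr_ae hW)
  have h' : partialD i (f : 𝓢'(Plane, ℂ)) = (W : 𝓢'(Plane, ℂ)) := by
    simpa using congrArg (fun u : 𝓢'(Plane, ℂ) => (𝓕⁻ u : 𝓢'(Plane, ℂ))) h
  rw [h']
  exact isGivenBy_Lp W

theorem isLambda_of_fourier_eq {i : Fin 2} {δ : ℝ} {f W : Lp ℂ 2 (volume : Measure Plane)}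
    (hW : (𝓕 W : Lp ℂ 2 (volume : Measure Plane)) =ᵐ[volume] fun ξ =>
      ((|2 * Real.pi * ξ i| ^ δ : ℝ) : ℂ) * (𝓕 f : Lp ℂ 2 (volume : Measure Plane)) ξ) :
    IsLambda i δ (f : 𝓢'(Plane, ℂ)) (W : 𝓢'(Plane, ℂ)) :=
  ⟨_, isGivenBy_fourier_Lp f, (isGivenBy_fourier_Lp W).congr_ae hW⟩

/-! ### The two inequalities -/

theorem memLp_of_eLpNorm_le_mul_rpow {f h W : Lp ℂ 2 (volume : Measure Plane)} {p : ℝ≥0∞}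
    {C : ℝ≥0} {x y : ℝ} (hx : 0 ≤ x) (hy : 0 ≤ y) (hf : MemLp f ∞ volume)
    (hW : eLpNorm W p volume ≤ C * eLpNorm f ∞ volume ^ x * eLpNorm h 2 volume ^ y) :
    MemLp W p volume :=
  ⟨Lp.aestronglyMeasurable W, hW.trans_lt (ENNReal.mul_lt_top
    (ENNReal.mul_lt_top ENNReal.coe_lt_top (ENNReal.rpow_lt_top_of_nonneg hx hf.2.ne))
    (ENNReal.rpow_lt_top_of_nonneg hy (Lp.memLp h).2.ne))⟩

/-- The multiplier `2πi r` is odd and homogeneous of degree one, so the odd symbol represents it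
with `δ = 1` and `s = γ + 1`. For `γ = 0` this is the endpoint `δ = s`. -/
theorem exists_eLpNorm_derivative_le {γ : ℝ} (hγ : 0 ≤ γ) :
    ∃ C : ℝ≥0, ∀ (i : Fin 2) (f h W : Lp ℂ 2 (volume : Measure Plane)), MemLp f ∞ volume →
      IsLambda i γ (partialD i (f : 𝓢'(Plane, ℂ))) (h : 𝓢'(Plane, ℂ)) →
      ((𝓕 W : Lp ℂ 2 (volume : Measure Plane)) =ᵐ[volume] fun ξ =>
        2 * Real.pi * Complex.I * ξ i * (𝓕 f : Lp ℂ 2 (volume : Measure Plane)) ξ) →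
      eLpNorm W (ENNReal.ofReal (2 * (γ + 1))) volume ≤
        C * eLpNorm f ∞ volume ^ (γ / (γ + 1)) * eLpNorm h 2 volume ^ (1 / (γ + 1)) := by
  rcases hγ.eq_or_lt with rfl | hγ
  · refine ⟨1, fun i f h W _ hfh hW => ?_⟩
    have := eLpNorm_two_eq_of_norm_multiplier_eq (W := W) (by norm_num)
      (μ := fun r => 2 * Real.pi * Complex.I * r)
      (fun r => by simp [abs_mul]) hfh hW
    simp [this]
  -- Large `j` ensures both `γ + 1 < 2j + 1`, the order of vanishing, and `j ≠ 0`, which makes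
  -- `oddConst j` nonzero.
  · obtain ⟨j, hj⟩ := exists_nat_gt (γ + 1)
    have hj0 : j ≠ 0 := by
      rintro rfl
      norm_num at hj
      linarith
    obtain ⟨C, hC⟩ := eLpNorm_le_of_multiplier_eq (ϱ := γ) (M := (2 * j + 1 : ℕ)) one_pos
      (by linarith) (by push_cast; linarith [(Nat.cast_nonneg j : (0 : ℝ) ≤ j)])
      (norm_oddSymbol_le j) (norm_oddSymbol_le_rpow j)
      (μ := fun r => 2 * Real.pi * Complex.I * r) (κ := 2 * Real.pi * Complex.I / oddConst j)
      (fun r => by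
        rw [integral_oddSymbol]
        field_simp [oddConst_ne_zero hj0])
    refine ⟨C, fun i f h W hf hfh hW => ?_⟩
    have := hC i f h W hf hfh hW
    rwa [div_one, show 1 - 1 / (γ + 1) = γ / (γ + 1) by field_simp; ring] at this

theorem exists_eLpNorm_lambda_le {ϱ δ : ℝ} (hδ : 0 < δ) (hδϱ : δ ≤ ϱ + 1) :
    ∃ C : ℝ≥0, ∀ (i : Fin 2) (f h W : Lp ℂ 2 (volume : Measure Plane)), MemLp f ∞ volume →
      IsLambda i ϱ (partialD i (f : 𝓢'(Plane, ℂ))) (h : 𝓢'(Plane, ℂ)) →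
      ((𝓕 W : Lp ℂ 2 (volume : Measure Plane)) =ᵐ[volume] fun ξ =>
        ((|2 * Real.pi * ξ i| ^ δ : ℝ) : ℂ) * (𝓕 f : Lp ℂ 2 (volume : Measure Plane)) ξ) →
      eLpNorm W (ENNReal.ofReal (2 * (ϱ + 1)) / ENNReal.ofReal δ) volume ≤
        C * eLpNorm f ∞ volume ^ (1 - δ / (ϱ + 1)) * eLpNorm h 2 volume ^ (δ / (ϱ + 1)) := by
  rw [← ENNReal.ofReal_div_of_pos hδ]
  rcases hδϱ.eq_or_lt with rfl | hδϱ
  · refine ⟨1, fun i f h W _ hfh hW => ?_⟩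
    have := eLpNorm_two_eq_of_norm_multiplier_eq (W := W) (by linarith)
      (μ := fun r => ((|2 * Real.pi * r| ^ (ϱ + 1) : ℝ) : ℂ))
      (fun r => by rw [Complex.norm_real, Real.norm_of_nonneg (by positivity)]) hfh hW
    rw [mul_div_assoc, div_self hδ.ne']
    simp [this]
  · obtain ⟨m, hm⟩ := exists_nat_gt (ϱ + 1)
    have hm0 : m ≠ 0 := by
      rintro rfl
      norm_num at hm
      linarith
    have hm' : ϱ + 1 < (2 * m : ℕ) := by
      push_cast
      linarith [(Nat.cast_nonneg m : (0 : ℝ) ≤ m)]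
    refine eLpNorm_le_of_multiplier_eq hδ hδϱ hm'
      (norm_centralSymbol_le m) (norm_centralSymbol_le_rpow m)
      (μ := fun r => ((|2 * Real.pi * r| ^ δ : ℝ) : ℂ))
      (κ := (((2 * Real.pi) ^ δ : ℝ) : ℂ) / centralConst m δ) fun r => ?_
    rw [integral_centralSymbol hm0 hδ, abs_mul, abs_of_pos (by positivity : 0 < 2 * Real.pi),
      Real.mul_rpow (by positivity) (abs_nonneg r)]
    have := centralConst_ne_zero hδ (hδϱ.trans hm')
    push_cast
    field_simp

theorem lemma2p3 :
    (∀ γ : ℝ, 0 ≤ γ → ∃ C : ℝ≥0, ∀ (i : Fin 2) (f h : Lp ℂ 2 (volume : Measure Plane)),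
      MemLp f ∞ volume →
      IsLambda i γ (partialD i (f : 𝓢'(Plane, ℂ))) (h : 𝓢'(Plane, ℂ)) →
      ∃ g : Plane → ℂ,
        MemLp g (ENNReal.ofReal (2 * (γ + 1))) volume ∧
        IsGivenBy (partialD i (f : 𝓢'(Plane, ℂ))) g ∧
        eLpNorm g (ENNReal.ofReal (2 * (γ + 1))) volume ≤
          C * eLpNorm f ∞ volume ^ (γ / (γ + 1)) * eLpNorm h 2 volume ^ (1 / (γ + 1))) ∧
    (∀ ϱ δ : ℝ, -1 < ϱ → 0 ≤ δ → δ ≤ ϱ + 1 →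
      ∃ C : ℝ≥0, ∀ (i : Fin 2) (f h : Lp ℂ 2 (volume : Measure Plane)),
      MemLp f ∞ volume →
      IsLambda i ϱ (partialD i (f : 𝓢'(Plane, ℂ))) (h : 𝓢'(Plane, ℂ)) →
      ∃ (w : 𝓢'(Plane, ℂ)) (g : Plane → ℂ),
        IsLambda i δ (f : 𝓢'(Plane, ℂ)) w ∧
        MemLp g (ENNReal.ofReal (2 * (ϱ + 1)) / ENNReal.ofReal δ) volume ∧
        IsGivenBy w g ∧
        eLpNorm g (ENNReal.ofReal (2 * (ϱ + 1)) / ENNReal.ofReal δ) volume ≤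
          C * eLpNorm f ∞ volume ^ (1 - δ / (ϱ + 1)) *
            eLpNorm h 2 volume ^ (δ / (ϱ + 1))) := by
  constructor
  · intro γ hγ
    obtain ⟨C, hC⟩ := exists_eLpNorm_derivative_le hγ
    refine ⟨C, fun i f h hf hfh => ?_⟩
    obtain ⟨W, hW⟩ := exists_Lp_fourier_eq (i := i) (δ := 1) (s := γ + 1) (K := 2 * Real.pi)
      zero_le_one (by linarith) (μ := fun r => 2 * Real.pi * Complex.I * r) (by fun_prop)
      (fun r => by simp [abs_of_pos Real.pi_pos])
      (ne_top_of_le_ne_top (ENNReal.pow_ne_top (Lp.memLp h).2.ne)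
        (lintegral_rpow_le_eLpNorm_sq (by linarith) hfh))
    have hle := hC i f h W hf hfh hW
    exact ⟨W, memLp_of_eLpNorm_le_mul_rpow (by positivity) (by positivity) hf hle,
      isGivenBy_partialD_of_fourier_eq hW, hle⟩
  · intro ϱ δ hϱ hδ hδϱ
    have hs : 0 < ϱ + 1 := by linarith
    rcases hδ.eq_or_lt with rfl | hδ
    -- For `δ = 0` the symbol is `1` everywhere, as `0 ^ 0 = 1`, so `Λ^0 f = f`; the exponent is a
    -- nonzero number divided by `0` in `ℝ≥0∞`, hence `∞`.
    · refine ⟨1, fun i f h hf hfh => ⟨f, f, isLambda_of_fourier_eq (by simp), ?_, isGivenBy_Lp f, ?_⟩⟩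
      · rw [ENNReal.ofReal_zero, ENNReal.div_zero (by simpa using hs)]
        exact hf
      · rw [ENNReal.ofReal_zero, ENNReal.div_zero (by simpa using hs)]
        simp
    · obtain ⟨C, hC⟩ := exists_eLpNorm_lambda_le hδ hδϱ
      refine ⟨C, fun i f h hf hfh => ?_⟩
      obtain ⟨W, hW⟩ := exists_Lp_fourier_eq (i := i) (δ := δ) (s := ϱ + 1)
        (K := (2 * Real.pi) ^ δ) hδ.le hδϱ (μ := fun r => ((|2 * Real.pi * r| ^ δ : ℝ) : ℂ))
        (by fun_prop)
        (fun r => by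
          rw [Complex.norm_real, Real.norm_of_nonneg (by positivity), abs_mul,
            abs_of_pos (by positivity : 0 < 2 * Real.pi),
            Real.mul_rpow (by positivity) (abs_nonneg r)])
        (ne_top_of_le_ne_top (ENNReal.pow_ne_top (Lp.memLp h).2.ne)
          (lintegral_rpow_le_eLpNorm_sq hϱ hfh))
      have hle := hC i f h W hf hfh hW
      refine ⟨W, W, isLambda_of_fourier_eq hW, memLp_of_eLpNorm_le_mul_rpow ?_ (by positivity) hf hle,
        isGivenBy_Lp W, hle⟩
      rw [sub_nonneg, div_le_one hs]
      exact hδϱ
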